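/- Let $\Gamma$ be a finite group and $n\ge 0$. Let $\Pi_n$ be the group generated by $a_1,\dots,a_n$ and a central element $z$ subject to $z^2=1$, $a_i^2=z$ and $a_ia_j=za_ja_i$ for $i\ne j$. Let $S_n$ act on $\Gamma^n\times\Pi_n$ by permuting the factors of $\Gamma^n$ and by $s(a_i)=a_{s(i)}$, $s(z)=z$, and put $\widetilde{H\Gamma}_n=(\Gamma^n\times\Pi_n)\rtimes S_n$ and $H\Gamma_n=(\Gamma\times\mathbb Z_2)^n\rtimes S_n$. Let $\theta_n:\widetilde{H\Gamma}_n\to H\Gamma_n$ be the double covering that is the identity on $\Gamma^n$ and $S_n$, sends $a_i$ to the generator $b_i$ of the $i$-th factor $\mathbb Z_2$, and sends $z$ to $1$. Write an element of $H\Gamma_n$ as $(g,b_Is)$ with $g\in\Gamma^n$, $s\in S_n$, $I\subseteq\{1,\dots,n\}$ and $b_I=\prod_{i\in I}b_i$. It is even (odd) if $|I|$ is even (odd). A cycle $(j_1\,j_2\cdots j_m)$ of $s$ (fixed points being cycles of length $1$) has sign $(-1)^{|I\cap\{j_1,\dots,j_m\}|}$ and cycle-product $g_{j_m}\cdots g_{j_2}g_{j_1}$,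 whose conjugacy class in $\Gamma$ is well defined. Let $\Gamma_*$ be the set of conjugacy classes of $\Gamma$. The type of $(g,b_Is)$ is the pair $(\rho^+,\rho^-)$ of partition-valued functions on $\Gamma_*$ for which the parts of $\rho^{\pm}(c)$ are the lengths of the cycles of sign $\pm$ with cycle-product in $c$. For partition-valued functions $\rho^+,\rho^-$ on $\Gamma_*$ with $\sum_{c}(|\rho^+(c)|+|\rho^-(c)|)=n$, let $C_{\rho^+,\rho^-}$ be the conjugacy class of $H\Gamma_n$ consisting of the elements of type $(\rho^+,\rho^-)$. It is called even (odd) if its elements are even (odd), and it is said to split if $\theta_n^{-1}(C_{\rho^+,\rho^-})$ is the union of two distinct conjugacy classes of $\widetilde{H\Gamma}_n$. Theorem. (1) If $C_{\rho^+,\rho^-}$ is even, then it splits if and only if $\rho^-=\emptyset$ and, for every $c\in\Gamma_*$, all parts of $\rho^+(c)$ are odd. (2) If $C_{\rho^+,\rho^-}$ is odd, then it splits if and only if $\rho^+=\emptyset$, for every $c\in\Gamma_*$ the parts of $\rho^-(c)$ are pairwise distinct, and the total number $\sum_{c}l(\rho^-(c))$ of parts of $\rho^-$ is odd. -/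

import Mathlib

namespace SpinWreath

/-! ### The group `Π_n` -/

/-- The generators of `Π_n`: the elements `a_i` for `i = 1, …, n`, and `z`. -/
inductive PiGen (n : ℕ) : Type
  | a : Fin n → PiGen n
  | z : PiGen n

/-- The relations of `Π_n`: `z` is central, `z ^ 2 = 1`, `a_i ^ 2 = z`, and
`a_i a_j = z a_j a_i` for `i ≠ j`. -/
inductive PiRel (n : ℕ) : FreeGroup (PiGen n) → FreeGroup (PiGen n) → Prop
  | z_central (i : Fin n) :
      PiRel n (FreeGroup.of PiGen.z * FreeGroup.of (PiGen.a i))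
        (FreeGroup.of (PiGen.a i) * FreeGroup.of PiGen.z)
  | z_sq : PiRel n (FreeGroup.of PiGen.z ^ 2) 1
  | a_sq (i : Fin n) : PiRel n (FreeGroup.of (PiGen.a i) ^ 2) (FreeGroup.of PiGen.z)
  | anticomm (i j : Fin n) (h : i ≠ j) :
      PiRel n (FreeGroup.of (PiGen.a i) * FreeGroup.of (PiGen.a j))
        (FreeGroup.of PiGen.z * FreeGroup.of (PiGen.a j) * FreeGroup.of (PiGen.a i))

/-- The relators of `Π_n`. -/
def piRels (n : ℕ) : Set (FreeGroup (PiGen n)) :=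
  {w | ∃ u v, PiRel n u v ∧ w = u * v⁻¹}

/-- The group `Π_n` with generators `a_1, …, a_n, z` and the relations above. -/
abbrev PiGroup (n : ℕ) : Type := PresentedGroup (piRels n)

/-- The generator `a_i` of `Π_n`. -/
def aGen {n : ℕ} (i : Fin n) : PiGroup n := PresentedGroup.of (PiGen.a i)

/-- The central generator `z` of `Π_n`. -/
def zGen (n : ℕ) : PiGroup n := PresentedGroup.of PiGen.z

theorem rel_eq {n : ℕ} {u v : FreeGroup (PiGen n)} (h : PiRel n u v) :
    PresentedGroup.mk (piRels n) u = PresentedGroup.mk (piRels n) v := by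
  have h1 : PresentedGroup.mk (piRels n) (u * v⁻¹) = 1 :=
    PresentedGroup.one_of_mem ⟨u, v, h, rfl⟩
  rwa [map_mul, map_inv, mul_inv_eq_one] at h1

theorem zGen_central {n : ℕ} (i : Fin n) : zGen n * aGen i = aGen i * zGen n :=
  rel_eq (PiRel.z_central i)

theorem zGen_sq (n : ℕ) : zGen n ^ 2 = 1 := rel_eq PiRel.z_sq

theorem aGen_sq {n : ℕ} (i : Fin n) : aGen i ^ 2 = zGen n := rel_eq (PiRel.a_sq i)

theorem aGen_anticomm {n : ℕ} {i j : Fin n} (h : i ≠ j) :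
    aGen i * aGen j = zGen n * aGen j * aGen i := rel_eq (PiRel.anticomm i j h)

/-- The homomorphism out of `Π_n` given by images of the generators satisfying the relations. -/
def piLift {n : ℕ} {G : Type*} [Group G] (a : Fin n → G) (z : G)
    (hc : ∀ i, z * a i = a i * z) (hz : z ^ 2 = 1) (ha : ∀ i, a i ^ 2 = z)
    (hanti : ∀ i j, i ≠ j → a i * a j = z * a j * a i) : PiGroup n →* G :=
  PresentedGroup.toGroup (f := fun g => PiGen.casesOn g a z) (by
    rintro w ⟨u, v, h, rfl⟩
    rw [map_mul, map_inv, mul_inv_eq_one]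
    cases h with
    | z_central i => simpa using hc i
    | z_sq => simpa using hz
    | a_sq i => simpa using ha i
    | anticomm i j h => simpa using hanti i j h)

@[simp] theorem piLift_a {n : ℕ} {G : Type*} [Group G] (a : Fin n → G) (z : G) (hc hz ha hanti)
    (i : Fin n) : piLift a z hc hz ha hanti (aGen i) = a i :=
  PresentedGroup.toGroup.of _

@[simp] theorem piLift_z {n : ℕ} {G : Type*} [Group G] (a : Fin n → G) (z : G) (hc hz ha hanti) :
    piLift a z hc hz ha hanti (zGen n) = z :=
  PresentedGroup.toGroup.of _

theorem piHom_ext {n : ℕ} {G : Type*} [Group G] {f g : PiGroup n →* G}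
    (ha : ∀ i, f (aGen i) = g (aGen i)) (hz : f (zGen n) = g (zGen n)) : f = g := by
  apply PresentedGroup.ext
  rintro (i | _)
  · exact ha i
  · exact hz

/-- The endomorphism of `Π_n` with `a_i ↦ a_{s(i)}` and `z ↦ z`. -/
def piPerm {n : ℕ} (s : Equiv.Perm (Fin n)) : PiGroup n →* PiGroup n :=
  piLift (fun i => aGen (s i)) (zGen n) (fun i => zGen_central (s i)) (zGen_sq n)
    (fun i => aGen_sq (s i)) (fun _ _ h => aGen_anticomm (s.injective.ne h))

theorem piPerm_one {n : ℕ} : piPerm (1 : Equiv.Perm (Fin n)) = MonoidHom.id _ :=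
  piHom_ext (fun i => by simp [piPerm]) (by simp [piPerm])

theorem piPerm_comp {n : ℕ} (s t : Equiv.Perm (Fin n)) :
    (piPerm s).comp (piPerm t) = piPerm (s * t) :=
  piHom_ext (fun i => by simp [piPerm]) (by simp [piPerm])

/-- The action of `S_n` on `Π_n` by automorphisms, `s(a_i) = a_{s(i)}` and `s(z) = z`. -/
def piAction (n : ℕ) : Equiv.Perm (Fin n) →* MulAut (PiGroup n) where
  toFun s :=
    MonoidHom.toMulEquiv (piPerm s) (piPerm s⁻¹)
      (by rw [piPerm_comp, inv_mul_cancel, piPerm_one])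
      (by rw [piPerm_comp, mul_inv_cancel, piPerm_one])
  map_one' := by
    ext x
    exact DFunLike.congr_fun piPerm_one x
  map_mul' s t := by
    ext x
    exact (DFunLike.congr_fun (piPerm_comp s t) x).symm

/-- The cyclic group `ℤ_2`, written multiplicatively. -/
abbrev Z2 : Type := Multiplicative (ZMod 2)

/-- The projection `Π_n → ℤ_2^n` with `a_i ↦ b_i` and `z ↦ 1`, where `b_i` is the
`i`-th standard generator of `ℤ_2^n`. -/
def piToZ2 (n : ℕ) : PiGroup n →* (Fin n → Z2) :=
  piLift (fun i => Pi.mulSingle i (Multiplicative.ofAdd 1)) 1 (fun i => by simp) (by simp)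
    (fun i => by
      rw [← Pi.mulSingle_pow]
      have h : (Multiplicative.ofAdd (1 : ZMod 2)) ^ 2 = 1 := by decide
      rw [h, Pi.mulSingle_one])
    (fun i j _ => by rw [one_mul, mul_comm])

/-! ### The wreath product and its double cover -/

/-- The action of `S_n` on `G^n`: `s(g_1, …, g_n) = (g_{s⁻¹(1)}, …, g_{s⁻¹(n)})`. -/
def permAction (G : Type*) [Group G] (n : ℕ) :
    Equiv.Perm (Fin n) →* MulAut (Fin n → G) where
  toFun s :=
    { toFun := fun g i => g (s⁻¹ i)
      invFun := fun g i => g (s i)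
      left_inv := fun g => by funext i; simp
      right_inv := fun g => by funext i; simp
      map_mul' := fun _ _ => rfl }
  map_one' := by ext g i; rfl
  map_mul' s t := by ext g i; simp

/-- The simultaneous action of `S_n` on `Γ^n × Π_n`. -/
def prodAction (Γ : Type*) [Group Γ] (n : ℕ) :
    Equiv.Perm (Fin n) →* MulAut ((Fin n → Γ) × PiGroup n) where
  toFun s := (permAction Γ n s).prodCongr (piAction n s)
  map_one' := by
    rw [map_one, map_one]
    rfl
  map_mul' s t := by
    rw [map_mul, map_mul]
    rfl

/-- The wreath product `HΓ_n = (Γ × ℤ_2)^n ⋊ S_n`. -/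
abbrev HG (Γ : Type*) [Group Γ] (n : ℕ) : Type _ :=
  (Fin n → Γ × Z2) ⋊[permAction (Γ × Z2) n] Equiv.Perm (Fin n)

/-- The group `Γ̃_n = (Γ^n × Π_n) ⋊ S_n`. -/
abbrev BG (Γ : Type*) [Group Γ] (n : ℕ) : Type _ :=
  ((Fin n → Γ) × PiGroup n) ⋊[prodAction Γ n] Equiv.Perm (Fin n)

/-- The homomorphism `Γ^n × Π_n → (Γ × ℤ_2)^n` induced by `Π_n → ℤ_2^n`. -/
def thetaLeft (Γ : Type*) [Group Γ] (n : ℕ) :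
    (Fin n → Γ) × PiGroup n →* (Fin n → Γ × Z2) where
  toFun x i := (x.1 i, piToZ2 n x.2 i)
  map_one' := by funext i; simp
  map_mul' x y := by funext i; simp

theorem piToZ2_piAction {n : ℕ} (s : Equiv.Perm (Fin n)) (x : PiGroup n) :
    piToZ2 n (piAction n s x) = permAction Z2 n s (piToZ2 n x) := by
  suffices h : (piToZ2 n).comp (piPerm s) =
      ((permAction Z2 n s : MulAut (Fin n → Z2)) : (Fin n → Z2) →* (Fin n → Z2)).comp
        (piToZ2 n) from DFunLike.congr_fun h x
  apply piHom_ext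
  · intro i
    funext j
    by_cases h : j = s i
    · subst h
      simp [piToZ2, piPerm, permAction]
    · have h' : s.symm j ≠ i := fun e => h (by rw [← e]; simp)
      simp [piToZ2, piPerm, permAction, Pi.mulSingle_eq_of_ne h, Pi.mulSingle_eq_of_ne h']
  · simp [piToZ2, piPerm]

/-- The double covering `θ_n : Γ̃_n → HΓ_n`, with `(g, a_i) ↦ (g, b_i)`, `z ↦ 1`, and the
identity on `S_n`. -/
def theta (Γ : Type*) [Group Γ] (n : ℕ) : BG Γ n →* HG Γ n :=
  SemidirectProduct.map (thetaLeft Γ n) (MonoidHom.id _) (by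
    intro s
    ext x i
    · rfl
    · exact congrFun (piToZ2_piAction s x.2) i)

/-! ### Partition-valued functions -/

/-- A partition of some non-negative integer. -/
abbrev Ptn : Type := Σ m : ℕ, m.Partition

namespace Ptn

/-- The size `|λ|` of a partition, i.e. the integer that it partitions. -/
def size (l : Ptn) : ℕ := l.1

/-- The multiset of parts of a partition. -/
def parts (l : Ptn) : Multiset ℕ := l.2.parts

/-- The length of a partition, i.e. its number of parts. -/
def length (l : Ptn) : ℕ := l.parts.card

/-- The partition with a given multiset of positive parts. -/
def ofParts (s : Multiset ℕ) (h : ∀ i ∈ s, 0 < i) : Ptn :=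
  ⟨s.sum, { parts := s, parts_pos := fun hi => h _ hi, parts_sum := rfl }⟩

/-- The empty partition, of `0`. -/
def empty : Ptn := ofParts 0 (by simp)

end Ptn

/-- `‖ρ‖ = ∑_x |ρ(x)|` for a partition-valued function on a finite set. -/
noncomputable def normSize {X : Type*} [Finite X] (ρ : X → Ptn) : ℕ := ∑ᶠ x, (ρ x).size

/-- The length `l(ρ) = ∑_x l(ρ(x))` of a partition-valued function on a finite set. -/
noncomputable def totalLength {X : Type*} [Finite X] (ρ : X → Ptn) : ℕ := ∑ᶠ x, (ρ x).length

/-- The empty partition-valued function. -/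
def emptyFun {X : Type*} : X → Ptn := fun _ => Ptn.empty

/-- `𝒪𝒫_n(X)`: the partition-valued functions of total size `n` all of whose parts are odd. -/
def OP (n : ℕ) (X : Type*) [Finite X] : Set (X → Ptn) :=
  {ρ | normSize ρ = n ∧ ∀ x, ∀ i ∈ (ρ x).parts, Odd i}

/-- `𝒮𝒫⁻_n(X)`: the partition-valued functions of total size `n` such that each `ρ(x)` is strict
(has distinct parts), and the total number of parts is odd. -/
def SPminus (n : ℕ) (X : Type*) [Finite X] : Set (X → Ptn) :=
  {ρ | normSize ρ = n ∧ (∀ x, (ρ x).parts.Nodup) ∧ Odd (totalLength ρ)}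

/-! ### Conjugacy classes of the wreath product -/

section Cycles

variable {Γ : Type*} [Group Γ] {n : ℕ}

/-- The set of cycles of a permutation, cycles of length one included. -/
abbrev Cycles (s : Equiv.Perm (Fin n)) : Type :=
  Quotient (Equiv.Perm.SameCycle.setoid s)

noncomputable instance (s : Equiv.Perm (Fin n)) : Fintype (Cycles s) := Fintype.ofFinite _

/-- The support of a cycle: the set of all points that it moves around (one point, for a cycle
of length one). -/
noncomputable def cycleSupport (s : Equiv.Perm (Fin n)) (q : Cycles s) : Finset (Fin n) :=
  open Classical in Finset.univ.filter (fun j => Quotient.mk _ j = q)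

/-- The length of a cycle. -/
noncomputable def cycleLength (s : Equiv.Perm (Fin n)) (q : Cycles s) : ℕ :=
  (cycleSupport s q).card

theorem cycleLength_pos (s : Equiv.Perm (Fin n)) (q : Cycles s) : 0 < cycleLength s q := by
  obtain ⟨j, hj⟩ := Quotient.exists_rep q
  exact Finset.card_pos.2 ⟨j, by simp [cycleSupport, hj]⟩

/-- The subset `I` of `{1, …, n}` for an element `(g, b_I s)`. -/
def negSet (x : HG Γ n) : Finset (Fin n) :=
  Finset.univ.filter (fun i => (x.left i).2 ≠ 1)

/-- The sign `(-1)^{|I ∩ supp|}` of a cycle of `(g, b_I s)`. -/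
noncomputable def cycleSign (x : HG Γ n) (q : Cycles x.right) : ℤˣ :=
  (-1) ^ (negSet x ∩ cycleSupport x.right q).card

/-- For the cycle `(j_1 j_2 … j_m)` of the permutation part of `x = (g, b_I s)` that starts at
`j_1 = j`, so that `j_{k+1} = s^k(j)` and `m` is the least positive integer with `s^m(j) = j`,
this is the product `g_{j_m} ⋯ g_{j_2} g_{j_1}`. -/
noncomputable def cycleProduct (x : HG Γ n) (j : Fin n) : Γ :=
  ((List.range (Function.minimalPeriod x.right j)).map
    (fun k => (x.left (x.right^[k] j)).1)).reverse.prod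

theorem cycleProduct_apply (x : HG Γ n) (j : Fin n) :
    IsConj (cycleProduct x j) (cycleProduct x (x.right j)) := by
  have hper : j ∈ Function.periodicPts x.right := x.right.injective.mem_periodicPts j
  have hpos := Function.minimalPeriod_pos_of_mem_periodicPts hper
  have hit := Function.iterate_minimalPeriod (f := x.right) (x := j)
  rw [isConj_iff]
  refine ⟨(x.left j).1, ?_⟩
  unfold cycleProduct
  rw [Function.minimalPeriod_apply hper]
  obtain ⟨m, hm⟩ := Nat.exists_eq_succ_of_ne_zero hpos.ne'
  rw [hm] at hit ⊢
  conv_lhs => rw [List.range_succ_eq_map]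
  conv_rhs => rw [List.range_succ]
  rw [Function.iterate_succ_apply] at hit
  simp [Function.comp_def, hit, mul_assoc]

theorem cycleProduct_sameCycle (x : HG Γ n) {j k : Fin n} (h : x.right.SameCycle j k) :
    IsConj (cycleProduct x j) (cycleProduct x k) := by
  obtain ⟨i, rfl⟩ := h.exists_nat_pow_eq
  clear h
  induction i with
  | zero => exact IsConj.refl _
  | succ i ih =>
    rw [pow_succ', Equiv.Perm.mul_apply]
    exact ih.trans (cycleProduct_apply x _)

/-- The conjugacy class of `Γ` that contains the cycle-product of a cycle. -/
noncomputable def cycleClass (x : HG Γ n) : Cycles x.right → ConjClasses Γ :=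
  Quotient.lift (fun j => ConjClasses.mk (cycleProduct x j))
    (fun _ _ h => ConjClasses.mk_eq_mk_iff_isConj.2 (cycleProduct_sameCycle x h))

/-- For a sign `ε`, the partition-valued function `ρ^ε` on the conjugacy classes of `Γ`: the parts
of `ρ^ε(c)` are the lengths of the cycles of `x` that have sign `ε` and cycle-product in `c`. -/
noncomputable def rho (x : HG Γ n) (ε : ℤˣ) (c : ConjClasses Γ) : Ptn :=
  open Classical in
  Ptn.ofParts
    ((Finset.univ.filter (fun q : Cycles x.right =>
      cycleSign x q = ε ∧ cycleClass x q = c)).val.map (cycleLength x.right))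
    (by
      intro i hi
      obtain ⟨q, -, rfl⟩ := Multiset.mem_map.1 hi
      exact cycleLength_pos _ q)

/-- The set `C_{ρ⁺, ρ⁻}` of all elements of `HΓ_n` of type `(ρ⁺, ρ⁻)`. -/
def classOfType (n : ℕ) (ρpos ρneg : ConjClasses Γ → Ptn) : Set (HG Γ n) :=
  {x | rho x 1 = ρpos ∧ rho x (-1) = ρneg}

/-- A class is even if it consists of even elements, i.e. of elements `(g, b_I s)` with `|I|`
even. -/
def IsEvenClass (C : Set (HG Γ n)) : Prop := ∀ x ∈ C, Even (negSet x).card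

/-- A class is odd if it consists of odd elements, i.e. of elements `(g, b_I s)` with `|I|`
odd. -/
def IsOddClass (C : Set (HG Γ n)) : Prop := ∀ x ∈ C, Odd (negSet x).card

/-- A class `C` of `HΓ_n` splits if `θ_n⁻¹(C)` is the union of two distinct conjugacy classes
of `Γ̃_n`. -/
def Splits (C : Set (HG Γ n)) : Prop :=
  ∃ D₁ D₂ : ConjClasses (BG Γ n), D₁ ≠ D₂ ∧ theta Γ n ⁻¹' C = D₁.carrier ∪ D₂.carrier

end Cycles

end SpinWreath

namespace SpinWreath

/-! ### The structure of `Π_n` -/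

section PiGroup

variable {n : ℕ}

/-! Write $z$ also for the central element of the double cover. The kernel of $\theta_n$ is
$\{1,z\}$ with $z\neq1$, so if $X$ lifts $x\in C$, then $\theta_n^{-1}(C)$ is the union of the
classes of $X$ and $zX$. Hence $C$ splits exactly when no $Y$ satisfies $YX=zXY$ (`splits_iff`). All
computations rest on the rule $uv=z^{\deg u\deg v+u\cdot v}vu$ in $\Pi_n$ (`piGroup_comm`), where
$u\cdot v$ is the dot product of the images in $\mathbb F_2^n$.

Three obstructions produce such a $Y$. (a) If $x$ is even and has a negative cycle, take a lift of
the restriction of $x$ to that cycle: it and the complementary part have disjoint supports and are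
both odd, so their lifts anticommute (`isConj_of_neg_cycle`). (b) For a positive cycle of length
$m+1$, take the product $a$ of the $a_j$ around it: rotating $a$ costs $z^m$, moving it past the
$\Pi_n$-part of $X$ costs $z^{(m+1)\deg x}$, and the total exponent is odd if $x$ is odd, or if $x$
is even and $m$ is odd (`isConj_of_pos_cycle`). (c) If two negative cycles have equal length and
class, choose a representative on which swapping them is a symmetry; the swap exchanges two
anticommuting generators (`isConj_of_model`).

Conversely, the components in $\Gamma$ may be discarded by an endomorphism fixing $z$. If all cycles
are positive of odd length, the stripped $x$ has odd order dividing some $N$, so $X^N$ is central,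
and $X\sim zX$ would give $X^N=zX^N$ (`not_isConj_of_odd_cycles`). If $x$ is odd and all cycles are
negative with distinct data, anything commuting with $x$ preserves each cycle, and after stripping
is a product of restrictions of $x$ to cycles. Each restriction is odd with even complement, so its
lifts commute with $X$; hence no $Y$ exists (`not_isConj_of_neg_cycles`).

Conjugacy in $H\Gamma_n$ is controlled by holonomies: the type determines the lengths and the
conjugacy classes of the holonomies, and these determine the element up to conjugacy
(`isConj_iff_rho_eq`). -/

theorem zGen_mul_self (n : ℕ) : zGen n * zGen n = 1 := by
  rw [← pow_two, zGen_sq]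

theorem aGen_mul_self (i : Fin n) : aGen i * aGen i = zGen n := by
  rw [← pow_two, aGen_sq]

theorem zGen_inv (n : ℕ) : (zGen n)⁻¹ = zGen n := inv_eq_of_mul_eq_one_right (zGen_mul_self n)

theorem aGen_inv (i : Fin n) : (aGen i)⁻¹ = zGen n * aGen i :=
  inv_eq_of_mul_eq_one_right (by
    rw [zGen_central, ← mul_assoc, aGen_mul_self, zGen_mul_self])

/-- Induction on a word in the generators. -/
theorem piGroup_induction {p : PiGroup n → Prop} (one : p 1)
    (a_mul : ∀ i u, p u → p (aGen i * u)) (z_mul : ∀ u, p u → p (zGen n * u))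
    (u : PiGroup n) : p u := by
  have hu : u ∈ Subgroup.closure (Set.range (PresentedGroup.of : PiGen n → PiGroup n)) := by
    rw [PresentedGroup.closure_range_of]; trivial
  induction hu using Subgroup.closure_induction_left with
  | one => exact one
  | mul_left x hx y _ ih =>
    obtain ⟨i | _, rfl⟩ := hx
    · exact a_mul i y ih
    · exact z_mul y ih
  | inv_mul_cancel x hx y _ ih =>
    obtain ⟨i | _, rfl⟩ := hx
    · change p ((aGen i)⁻¹ * y)
      rw [aGen_inv, mul_assoc]
      exact z_mul _ (a_mul _ _ ih)
    · change p ((zGen n)⁻¹ * y)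
      rw [zGen_inv]
      exact z_mul _ ih

theorem zGen_comm (u : PiGroup n) : zGen n * u = u * zGen n := by
  induction u using piGroup_induction with
  | one => simp
  | a_mul i u ih => rw [← mul_assoc, zGen_central, mul_assoc, ih, mul_assoc]
  | z_mul u ih => rw [mul_assoc, ← ih]

/-- The central element `z ^ e` for an exponent `e` modulo `2`. -/
def zPow (n : ℕ) (e : ZMod 2) : PiGroup n := zGen n ^ e.val

@[simp] theorem zPow_zero (n : ℕ) : zPow n 0 = 1 := by simp [zPow]

@[simp] theorem zPow_one (n : ℕ) : zPow n 1 = zGen n := by simp [zPow, ZMod.val_one]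

theorem zmod_two_cases (e : ZMod 2) : e = 0 ∨ e = 1 := by
  revert e; decide

theorem zPow_add (e f : ZMod 2) : zPow n (e + f) = zPow n e * zPow n f := by
  have h : (1 + 1 : ZMod 2) = 0 := by decide
  rcases zmod_two_cases e with rfl | rfl <;> rcases zmod_two_cases f with rfl | rfl <;>
    simp [h, zGen_mul_self]

theorem zPow_comm (e : ZMod 2) (u : PiGroup n) : zPow n e * u = u * zPow n e := by
  rcases zmod_two_cases e with rfl | rfl <;> simp [zGen_comm]

/-- The coordinates in `𝔽_2` of the image of an element of `Π_n` in `ℤ_2^n`. -/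
def piVec (u : PiGroup n) (i : Fin n) : ZMod 2 := Multiplicative.toAdd (piToZ2 n u i)

@[simp] theorem piVec_one (i : Fin n) : piVec (1 : PiGroup n) i = 0 := by simp [piVec]

@[simp] theorem piVec_mul (u v : PiGroup n) (i : Fin n) :
    piVec (u * v) i = piVec u i + piVec v i := by simp [piVec]

@[simp] theorem piVec_z (i : Fin n) : piVec (zGen n) i = 0 := by simp [piVec, piToZ2]

@[simp] theorem piVec_zPow (e : ZMod 2) (i : Fin n) : piVec (zPow n e) i = 0 := by
  rcases zmod_two_cases e with rfl | rfl <;> simp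

@[simp] theorem piVec_a (i j : Fin n) : piVec (aGen i) j = if j = i then 1 else 0 := by
  by_cases h : j = i
  · subst h; simp [piVec, piToZ2]
  · simp [piVec, piToZ2, h]

/-- The degree modulo `2` in the generators `a_i`. -/
def piDeg (u : PiGroup n) : ZMod 2 := ∑ i, piVec u i

@[simp] theorem piDeg_one : piDeg (1 : PiGroup n) = 0 := by simp [piDeg]

@[simp] theorem piDeg_mul (u v : PiGroup n) : piDeg (u * v) = piDeg u + piDeg v := by
  simp [piDeg, Finset.sum_add_distrib]

@[simp] theorem piDeg_z : piDeg (zGen n) = 0 := by simp [piDeg]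

@[simp] theorem piDeg_a (i : Fin n) : piDeg (aGen i) = 1 := by simp [piDeg]

/-- Passing each letter of `v` costs one $z$, which gives `piDeg v`; letters equal to $a_i$ cost
nothing, which is corrected by `piVec v i`. -/
theorem piGroup_comm_aGen (i : Fin n) (v : PiGroup n) :
    aGen i * v = zPow n (piDeg v + piVec v i) * (v * aGen i) := by
  induction v using piGroup_induction with
  | one => simp
  | a_mul j v ih =>
    have h : aGen i * aGen j = zPow n (1 + if i = j then 1 else 0) * (aGen j * aGen i) := by
      by_cases h : i = j
      · subst h
        have h2 : (1 + 1 : ZMod 2) = 0 := by decide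
        simp [h2]
      · simp [h, aGen_anticomm h, mul_assoc]
    rw [← mul_assoc, h, mul_assoc, mul_assoc, ih, ← mul_assoc (aGen j), ← zPow_comm, mul_assoc,
      ← mul_assoc (zPow n _), ← zPow_add, piDeg_mul, piVec_mul, piDeg_a, piVec_a, mul_assoc]
    congr 2
    ring
  | z_mul v ih =>
    rw [← mul_assoc, ← zGen_comm, mul_assoc, ih, ← mul_assoc, zGen_comm]
    simp [mul_assoc]

/-- The commutation rule in `Π_n`. -/
theorem piGroup_comm (u v : PiGroup n) :
    u * v = zPow n (piDeg u * piDeg v + ∑ i, piVec u i * piVec v i) * (v * u) := by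
  induction u using piGroup_induction with
  | one => simp
  | a_mul j u ih =>
    rw [mul_assoc, ih, ← mul_assoc, ← zPow_comm, mul_assoc, ← mul_assoc (aGen j),
      piGroup_comm_aGen j v, mul_assoc, mul_assoc, ← mul_assoc, ← zPow_add]
    simp only [piDeg_mul, piDeg_a, piVec_mul, piVec_a, add_mul, Finset.sum_add_distrib, ite_mul,
      one_mul, zero_mul, Finset.sum_ite_eq', Finset.mem_univ, if_true]
    congr 2
    ring
  | z_mul u ih =>
    rw [mul_assoc, ih, ← mul_assoc v, ← zGen_comm v, ← mul_assoc, ← zPow_comm]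
    simp [mul_assoc]

/-- The product of the `a_i` over a list of indices. -/
def aProd (l : List (Fin n)) : PiGroup n := (l.map aGen).prod

@[simp] theorem aProd_nil : aProd ([] : List (Fin n)) = 1 := rfl

@[simp] theorem aProd_cons (i : Fin n) (l : List (Fin n)) :
    aProd (i :: l) = aGen i * aProd l := by simp [aProd]

@[simp] theorem aProd_append (l l' : List (Fin n)) :
    aProd (l ++ l') = aProd l * aProd l' := by simp [aProd]

theorem piVec_aProd (l : List (Fin n)) (i : Fin n) : piVec (aProd l) i = l.count i := by
  induction l with
  | nil => simp
  | cons j l ih =>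
    simp only [aProd_cons, piVec_mul, piVec_a, ih, List.count_cons, beq_iff_eq]
    by_cases h : i = j
    · subst h; simp [add_comm]
    · simp [h, Ne.symm h]

theorem piDeg_aProd (l : List (Fin n)) : piDeg (aProd l) = l.length := by
  induction l with
  | nil => simp
  | cons j l ih => simp [ih, add_comm]

theorem exists_aProd (u : PiGroup n) : ∃ e l, u = zPow n e * aProd l := by
  induction u using piGroup_induction with
  | one => exact ⟨0, [], by simp⟩
  | a_mul i u ih =>
    obtain ⟨e, l, rfl⟩ := ih
    exact ⟨e, i :: l, by rw [aProd_cons, ← mul_assoc, ← zPow_comm, mul_assoc]⟩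
  | z_mul u ih =>
    obtain ⟨e, l, rfl⟩ := ih
    exact ⟨1 + e, l, by rw [zPow_add, zPow_one, mul_assoc]⟩

/-- The first letter occurs an even number of times, hence recurs; moving it next to its second
occurrence replaces the pair by a power of $z$. Two letters disappear at once, so the induction is
on a bound for the length. -/
theorem aProd_eq_zPow (m : ℕ) : ∀ l : List (Fin n), l.length ≤ m →
    (∀ i, piVec (aProd l) i = 0) → ∃ e, aProd l = zPow n e := by
  induction m with
  | zero =>
    intro l hl _
    rw [List.length_eq_zero_iff.1 (Nat.le_zero.1 hl)]
    exact ⟨0, by simp⟩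
  | succ m ih =>
    rintro (_ | ⟨i, l⟩) hl h
    · exact ⟨0, by simp⟩
    · have hi : i ∈ l := by
        by_contra hi
        have := h i
        rw [piVec_aProd, List.count_cons_self, List.count_eq_zero_of_not_mem hi] at this
        simp at this
      obtain ⟨l₁, l₂, rfl⟩ := List.append_of_mem hi
      have key : aProd (i :: (l₁ ++ i :: l₂)) =
          zPow n (piDeg (aProd l₁) + piVec (aProd l₁) i + 1) * aProd (l₁ ++ l₂) := by
        simp only [aProd_cons, aProd_append]
        rw [← mul_assoc, piGroup_comm_aGen i (aProd l₁), zPow_add _ 1, zPow_one, mul_assoc,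
          mul_assoc, mul_assoc, ← mul_assoc (aGen i), aGen_mul_self, ← mul_assoc (aProd l₁),
          ← zGen_comm, mul_assoc]
      obtain ⟨e, he⟩ := ih (l₁ ++ l₂) (by simp at hl ⊢; omega) (fun j => by
        have := h j
        rwa [key, piVec_mul, piVec_zPow, zero_add] at this)
      exact ⟨_, by rw [key, he, ← zPow_add]⟩

/-- The kernel of $\Pi_n\to\mathbb Z_2^n$ is generated by $z$; apply this to $uv^{-1}$. -/
theorem eq_zPow_mul_of_piVec_eq {u v : PiGroup n} (h : ∀ i, piVec u i = piVec v i) :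
    ∃ e, u = zPow n e * v := by
  obtain ⟨e, l, hl⟩ := exists_aProd (u * v⁻¹)
  have hinv : ∀ i, piVec v⁻¹ i = - piVec v i := fun i => by simp [piVec]
  obtain ⟨f, hf⟩ := aProd_eq_zPow _ l le_rfl (fun i => by
    have := congrArg (fun w => piVec w i) hl
    simp only [piVec_mul, hinv, h, piVec_zPow, zero_add, add_neg_cancel] at this
    exact this.symm)
  refine ⟨e + f, ?_⟩
  rw [zPow_add, ← hf, ← hl, inv_mul_cancel_right]

@[simp] theorem piAction_a (s : Equiv.Perm (Fin n)) (i : Fin n) :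
    piAction n s (aGen i) = aGen (s i) := by
  change piPerm s (aGen i) = _
  simp [piPerm]

@[simp] theorem piAction_z (s : Equiv.Perm (Fin n)) : piAction n s (zGen n) = zGen n := by
  change piPerm s (zGen n) = _
  simp [piPerm]

@[simp] theorem piAction_zPow (s : Equiv.Perm (Fin n)) (e : ZMod 2) :
    piAction n s (zPow n e) = zPow n e := by
  rcases zmod_two_cases e with rfl | rfl <;> simp

@[simp] theorem piAction_aProd (s : Equiv.Perm (Fin n)) (l : List (Fin n)) :
    piAction n s (aProd l) = aProd (l.map s) := by
  induction l with
  | nil => simp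
  | cons i l ih => simp [ih]

/-- Normal form in which the order of the indices is free, so that it can be adapted to a given
permutation. -/
theorem exists_nodup_aProd (u : PiGroup n) (l : List (Fin n)) (hl : l.Nodup)
    (h : ∀ i, i ∈ l ↔ piVec u i ≠ 0) : ∃ e, u = zPow n e * aProd l := by
  apply eq_zPow_mul_of_piVec_eq
  intro i
  rw [piVec_aProd]
  by_cases hi : i ∈ l
  · rw [List.count_eq_one_of_mem hl hi, Nat.cast_one]
    exact (zmod_two_cases _).resolve_left ((h i).1 hi)
  · rw [List.count_eq_zero_of_not_mem hi, Nat.cast_zero]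
    exact not_not.1 fun h' => hi ((h i).2 h')

theorem piVec_surjective (f : Fin n → ZMod 2) : ∃ u : PiGroup n, ∀ i, piVec u i = f i := by
  refine ⟨aProd ((Finset.univ.filter (fun i => f i ≠ 0)).toList), fun i => ?_⟩
  rw [piVec_aProd]
  by_cases hi : f i = 0
  · rw [List.count_eq_zero_of_not_mem (by simpa using hi), hi, Nat.cast_zero]
  · rw [List.count_eq_one_of_mem (Finset.nodup_toList _) (by simpa using hi), Nat.cast_one]
    exact ((zmod_two_cases _).resolve_left hi).symm

theorem piAction_eq_self {s : Equiv.Perm (Fin n)} {u : PiGroup n}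
    (h : ∀ i, piVec u i ≠ 0 → s i = i) : piAction n s u = u := by
  obtain ⟨e, he⟩ := exists_nodup_aProd u (Finset.univ.filter (fun i => piVec u i ≠ 0)).toList
    (Finset.nodup_toList _) (by simp)
  rw [he, map_mul, piAction_zPow, piAction_aProd]
  congr 2
  conv_rhs => rw [← List.map_id (Finset.toList _)]
  apply List.map_congr_left
  intro i hi
  exact h i (by simpa using hi)

/-- A permutation that swaps two of the indices that occur in `u` and fixes the others
multiplies `u` by `z`. -/
theorem piAction_swap {s : Equiv.Perm (Fin n)} {u : PiGroup n} {p q : Fin n} (hpq : p ≠ q)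
    (hp : piVec u p ≠ 0) (hq : piVec u q ≠ 0) (hsp : s p = q) (hsq : s q = p)
    (h : ∀ i, piVec u i ≠ 0 → i ≠ p → i ≠ q → s i = i) : piAction n s u = zGen n * u := by
  set l := (Finset.univ.filter (fun i => piVec u i ≠ 0 ∧ i ≠ p ∧ i ≠ q)).toList with hl
  obtain ⟨e, he⟩ := exists_nodup_aProd u (p :: q :: l)
    (by simp [hl, hpq, Finset.nodup_toList]) (fun i => by
      by_cases hip : i = p
      · simp [hip, hp]
      · by_cases hiq : i = q
        · simp [hiq, hq]
        · simp [hl, hip, hiq])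
  have hm : l.map s = l := by
    conv_rhs => rw [← List.map_id l]
    apply List.map_congr_left
    intro i hi
    have := (by simpa [hl] using hi : piVec u i ≠ 0 ∧ i ≠ p ∧ i ≠ q)
    exact h i this.1 this.2.1 this.2.2
  rw [he, map_mul, piAction_zPow, piAction_aProd, List.map_cons, List.map_cons, hsp, hsq, hm]
  simp only [aProd_cons]
  rw [← mul_assoc (aGen q), aGen_anticomm hpq.symm, ← mul_assoc (zGen n), zGen_comm (zPow n e)]
  simp [mul_assoc]

/-- A cyclic rotation of the indices of a product of `m` distinct generators multiplies it by
`z ^ (m - 1)`. -/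
theorem aProd_rotate {i : Fin n} {l : List (Fin n)} (hi : i ∉ l) :
    aProd (l ++ [i]) = zPow n l.length * aProd (i :: l) := by
  rw [aProd_cons, piGroup_comm_aGen i, piDeg_aProd, piVec_aProd, List.count_eq_zero_of_not_mem hi,
    Nat.cast_zero, add_zero, ← mul_assoc, ← zPow_add, CharTwo.add_self_eq_zero]
  simp

end PiGroup

/-! ### A concrete model, showing that `z ≠ 1` -/

/-- The central extension of `𝔽_2^n` by `𝔽_2` given by the bilinear cocycle
`∑_{j ≤ i} u_i v_j`. -/
@[ext] structure PiModel (n : ℕ) : Type where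
  vec : Fin n → ZMod 2
  cen : ZMod 2

namespace PiModel

variable {n : ℕ}

/-- The bilinear cocycle. -/
def cocycle (u v : Fin n → ZMod 2) : ZMod 2 := ∑ i, ∑ j, if j ≤ i then u i * v j else 0

theorem cocycle_add_left (u v w : Fin n → ZMod 2) :
    cocycle (u + v) w = cocycle u w + cocycle v w := by
  simp only [cocycle, ← Finset.sum_add_distrib]
  refine Finset.sum_congr rfl fun i _ => Finset.sum_congr rfl fun j _ => ?_
  split_ifs <;> simp [add_mul]

theorem cocycle_add_right (u v w : Fin n → ZMod 2) :
    cocycle u (v + w) = cocycle u v + cocycle u w := by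
  simp only [cocycle, ← Finset.sum_add_distrib]
  refine Finset.sum_congr rfl fun i _ => Finset.sum_congr rfl fun j _ => ?_
  split_ifs <;> simp [mul_add]

theorem cocycle_single (i j : Fin n) :
    cocycle (Pi.single i 1) (Pi.single j 1) = if j ≤ i then 1 else 0 := by
  rw [cocycle, Finset.sum_eq_single i, Finset.sum_eq_single j]
  · simp
  · intro k _ hk; simp [hk]
  · simp
  · intro k _ hk; simp [hk]
  · simp

theorem cocycle_zero_left (v : Fin n → ZMod 2) : cocycle 0 v = 0 := by simp [cocycle]

theorem cocycle_zero_right (v : Fin n → ZMod 2) : cocycle v 0 = 0 := by simp [cocycle]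

instance : Mul (PiModel n) := ⟨fun x y => ⟨x.vec + y.vec, x.cen + y.cen + cocycle x.vec y.vec⟩⟩

instance : One (PiModel n) := ⟨⟨0, 0⟩⟩

instance : Inv (PiModel n) := ⟨fun x => ⟨x.vec, x.cen + cocycle x.vec x.vec⟩⟩

@[simp] theorem mul_vec (x y : PiModel n) : (x * y).vec = x.vec + y.vec := rfl

@[simp] theorem mul_cen (x y : PiModel n) :
    (x * y).cen = x.cen + y.cen + cocycle x.vec y.vec := rfl

@[simp] theorem one_vec : (1 : PiModel n).vec = 0 := rfl

@[simp] theorem one_cen : (1 : PiModel n).cen = 0 := rfl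

theorem add_self_vec (u : Fin n → ZMod 2) : u + u = 0 :=
  funext fun i => CharTwo.add_self_eq_zero (u i)

instance : Group (PiModel n) :=
  Group.ofLeftAxioms
    (fun x y z => by
      ext1
      · simp [add_assoc]
      · simp only [mul_vec, mul_cen, cocycle_add_left, cocycle_add_right]; ring)
    (fun x => by ext1 <;> simp [cocycle_zero_left])
    (fun x => by
      ext1
      · exact add_self_vec _
      · change x.cen + cocycle x.vec x.vec + x.cen + cocycle x.vec x.vec = 0
        rw [add_assoc]
        exact CharTwo.add_self_eq_zero _)

end PiModel

/-- The presentation alone does not exclude collapse. In the model the diagonal terms of the cocycle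
give $a_i^2=z$, its asymmetry gives anticommutation, and $z$ goes to the nontrivial central element.
-/
theorem zGen_ne_one (n : ℕ) : zGen n ≠ 1 := by
  intro h
  have h2 : (1 + 1 : ZMod 2) = 0 := by decide
  let f : PiGroup n →* PiModel n := piLift (fun i => ⟨Pi.single i 1, 0⟩) ⟨0, 1⟩
    (fun i => by
      ext1
      · simp
      · simp [PiModel.cocycle_zero_left, PiModel.cocycle_zero_right])
    (by
      rw [pow_two]
      ext1
      · simp
      · simp [PiModel.cocycle_zero_left, h2])
    (fun i => by
      rw [pow_two]
      ext1
      · exact PiModel.add_self_vec _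
      · simp [PiModel.cocycle_single])
    (fun i j hij => by
      ext1
      · simp [add_comm]
      · simp only [PiModel.mul_vec, PiModel.mul_cen, PiModel.cocycle_zero_left, zero_add,
          PiModel.cocycle_single, add_zero]
        rcases lt_or_gt_of_ne hij with hlt | hlt
        · simp [hlt.le, not_le.2 hlt, h2]
        · simp [hlt.le, not_le.2 hlt])
  have := congrArg PiModel.cen (congrArg f h)
  rw [map_one] at this
  simp [f] at this

/-! ### Cocycles and holonomies in the wreath product -/

section Holonomy

variable {Γ : Type*} [Group Γ] {n : ℕ}

/-- The coefficient with which `x` carries the point `i` to `x.right i`. -/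
def coeff (x : HG Γ n) (i : Fin n) : Γ × Z2 := x.left (x.right i)

/-- Indexing by the source point turns multiplication into a cocycle rule without inverses. -/
theorem coeff_mul (x y : HG Γ n) (i : Fin n) :
    coeff (x * y) i = coeff x (y.right i) * coeff y i := by
  simp [coeff, permAction]

@[simp] theorem coeff_one (i : Fin n) : coeff (1 : HG Γ n) i = 1 := rfl

theorem left_eq_coeff (x : HG Γ n) (i : Fin n) : x.left i = coeff x (x.right⁻¹ i) := by
  simp [coeff]

theorem hg_ext {x y : HG Γ n} (hc : ∀ i, coeff x i = coeff y i)
    (hr : ∀ i, x.right i = y.right i) : x = y := by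
  have h : x.right = y.right := Equiv.ext hr
  refine SemidirectProduct.ext (funext fun i => ?_) h
  rw [left_eq_coeff, left_eq_coeff, hc, h]

@[simp] theorem pow_right (x : HG Γ n) (k : ℕ) : (x ^ k).right = x.right ^ k :=
  map_pow (SemidirectProduct.rightHom : HG Γ n →* _) x k

theorem perm_pow_apply (s : Equiv.Perm (Fin n)) (k : ℕ) (i : Fin n) :
    (s ^ k) i = s^[k] i := by
  rw [Equiv.Perm.iterate_eq_pow]

theorem coeff_pow_succ (x : HG Γ n) (k : ℕ) (i : Fin n) :
    coeff (x ^ (k + 1)) i = coeff x (x.right^[k] i) * coeff (x ^ k) i := by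
  rw [pow_succ', coeff_mul, pow_right, perm_pow_apply]

theorem coeff_iterate (x : HG Γ n) (k : ℕ) (i : Fin n) :
    coeff x (x.right^[k] i) = x.left (x.right^[k] (x.right i)) := by
  rw [← Function.iterate_succ_apply, Function.iterate_succ_apply']
  rfl

/-- The length of the cycle through `i`. -/
noncomputable def period (s : Equiv.Perm (Fin n)) (i : Fin n) : ℕ := Function.minimalPeriod s i

theorem period_pos (s : Equiv.Perm (Fin n)) (i : Fin n) : 0 < period s i :=
  Function.minimalPeriod_pos_of_mem_periodicPts (s.injective.mem_periodicPts i)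

@[simp] theorem iterate_period (s : Equiv.Perm (Fin n)) (i : Fin n) : s^[period s i] i = i :=
  Function.iterate_minimalPeriod

theorem period_apply (s : Equiv.Perm (Fin n)) (i : Fin n) : period s (s i) = period s i :=
  Function.minimalPeriod_apply (s.injective.mem_periodicPts i)

/-- The holonomy of `x` around the cycle through `i`. -/
noncomputable def holonomy (x : HG Γ n) (i : Fin n) : Γ × Z2 :=
  coeff (x ^ period x.right i) i

theorem period_conj {x x' y : HG Γ n} (h : y * x = x' * y) (i : Fin n) :
    period x'.right (y.right i) = period x.right i := by
  have hr : ∀ j, y.right (x.right j) = x'.right (y.right j) := fun j =>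
    Equiv.congr_fun (congrArg SemidirectProduct.right h) j
  have hk : ∀ k j, y.right (x.right^[k] j) = x'.right^[k] (y.right j) := by
    intro k
    induction k with
    | zero => simp
    | succ k ih => intro j; rw [Function.iterate_succ_apply, ih, hr, Function.iterate_succ_apply]
  refine Function.minimalPeriod_eq_minimalPeriod_iff.2 fun k => ?_
  rw [Function.IsPeriodicPt, Function.IsFixedPt, ← hk, y.right.injective.eq_iff]
  rfl

/-- Compare the coefficients at `i` in $yx^m=x'^my$, where $m$ is the period and so $x^m$ fixes `i`.
-/
theorem holonomy_conj {x x' y : HG Γ n} (h : y * x = x' * y) (i : Fin n) :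
    holonomy x' (y.right i) = coeff y i * holonomy x i * (coeff y i)⁻¹ := by
  have hm : y * x ^ period x.right i = x' ^ period x.right i * y :=
    (SemiconjBy.pow_right (show SemiconjBy y x x' from h) _)
  have := congrArg (fun w => coeff w i) hm
  simp only [coeff_mul, pow_right, perm_pow_apply, iterate_period] at this
  rw [holonomy, period_conj h, holonomy, eq_mul_inv_iff_mul_eq, this]

theorem snd_conj (a b : Γ × Z2) : (a * b * a⁻¹).2 = b.2 := by
  simp

theorem iterate_eq_iff_mod (s : Equiv.Perm (Fin n)) (i : Fin n) (k l : ℕ) :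
    s^[k] i = s^[l] i ↔ k % period s i = l % period s i := by
  have h1 : s^[k % period s i] i = s^[k] i := Function.iterate_mod_minimalPeriod_eq
  have h2 : s^[l % period s i] i = s^[l] i := Function.iterate_mod_minimalPeriod_eq
  rw [← h1, ← h2]
  exact Function.iterate_eq_iterate_iff_of_lt_minimalPeriod (Nat.mod_lt _ (period_pos s i))
    (Nat.mod_lt _ (period_pos s i))

theorem iterate_eq_iff {s s' : Equiv.Perm (Fin n)} {i i' : Fin n}
    (h : period s i = period s' i') (k l : ℕ) :
    s^[k] i = s^[l] i ↔ s'^[k] i' = s'^[l] i' := by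
  rw [iterate_eq_iff_mod, iterate_eq_iff_mod, h]

/-- The coefficients of the powers along a cycle are determined by those below the period. -/
theorem coeff_pow_add_period (x : HG Γ n) (k : ℕ) (i : Fin n) :
    coeff (x ^ (k + period x.right i)) i = coeff (x ^ k) i * holonomy x i := by
  rw [pow_add, coeff_mul, pow_right, perm_pow_apply, iterate_period]
  rfl

theorem coeff_pow_add_mul_period (x : HG Γ n) (k l : ℕ) (i : Fin n) :
    coeff (x ^ (k + period x.right i * l)) i = coeff (x ^ k) i * holonomy x i ^ l := by
  induction l with
  | zero => simp
  | succ l ih => rw [mul_add, mul_one, ← add_assoc, coeff_pow_add_period, ih, mul_assoc, pow_succ]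

/-! ### Cycle data in terms of holonomies -/

theorem mk_apply_eq (s : Equiv.Perm (Fin n)) (i : Fin n) :
    (Quotient.mk _ (s i) : Cycles s) = Quotient.mk _ i :=
  Quotient.sound (Equiv.Perm.sameCycle_apply_left.2 (Equiv.Perm.SameCycle.refl s i))

theorem mk_iterate_eq (s : Equiv.Perm (Fin n)) (k : ℕ) (i : Fin n) :
    (Quotient.mk _ (s^[k] i) : Cycles s) = Quotient.mk _ i := by
  induction k with
  | zero => rfl
  | succ k ih => rw [Function.iterate_succ_apply', mk_apply_eq, ih]

theorem exists_iterate_of_mk_eq {s : Equiv.Perm (Fin n)} {i j : Fin n}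
    (h : (Quotient.mk _ i : Cycles s) = Quotient.mk _ j) : ∃ k, s^[k] i = j := by
  obtain ⟨k, hk⟩ := Equiv.Perm.SameCycle.exists_nat_pow_eq (Quotient.exact h)
  exact ⟨k, by rw [← perm_pow_apply, hk]⟩

theorem mem_cycleSupport {s : Equiv.Perm (Fin n)} {q : Cycles s} {i : Fin n} :
    i ∈ cycleSupport s q ↔ Quotient.mk _ i = q := by
  simp [cycleSupport]

theorem iterate_injOn (s : Equiv.Perm (Fin n)) (i : Fin n) :
    Set.InjOn (fun k => s^[k] i) (Finset.range (period s i)) := by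
  intro k hk l hl h
  exact Function.iterate_injOn_Iio_minimalPeriod (by simpa [period] using hk)
    (by simpa [period] using hl) h

theorem cycleSupport_eq_image (s : Equiv.Perm (Fin n)) (i : Fin n) :
    cycleSupport s (Quotient.mk _ i) =
      (Finset.range (period s i)).image (fun k => s^[k] i) := by
  ext j
  rw [mem_cycleSupport, Finset.mem_image]
  constructor
  · intro h
    obtain ⟨k, rfl⟩ := exists_iterate_of_mk_eq h.symm
    exact ⟨k % period s i, Finset.mem_range.2 (Nat.mod_lt _ (period_pos s i)),
      Function.iterate_mod_minimalPeriod_eq⟩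
  · rintro ⟨k, -, rfl⟩
    exact mk_iterate_eq s k i

theorem cycleLength_mk (s : Equiv.Perm (Fin n)) (i : Fin n) :
    cycleLength s (Quotient.mk _ i) = period s i := by
  rw [cycleLength, cycleSupport_eq_image, Finset.card_image_of_injOn (iterate_injOn s i),
    Finset.card_range]

theorem prod_range_left (x : HG Γ n) (k : ℕ) (i : Fin n) :
    ((List.range k).map (fun l => (x.left (x.right^[l] (x.right i))).1)).reverse.prod =
      (coeff (x ^ k) i).1 := by
  induction k with
  | zero => simp
  | succ k ih =>
    rw [List.range_succ, List.map_append, List.reverse_append, List.prod_append, ih,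
      coeff_pow_succ, Prod.fst_mul, coeff_iterate]
    simp

theorem cycleClass_mk (x : HG Γ n) (i : Fin n) :
    cycleClass x (Quotient.mk _ i) = ConjClasses.mk (holonomy x i).1 := by
  -- `coeff` at `i` reads the entry at the image of `i`, so the holonomy at `i` is the cycle-product
  -- started one step later.
  rw [← mk_apply_eq]
  change ConjClasses.mk (cycleProduct x (x.right i)) = _
  rw [cycleProduct]
  change ConjClasses.mk ((List.range (period x.right (x.right i))).map
    (fun k => (x.left (x.right^[k] (x.right i))).1)).reverse.prod = _
  rw [prod_range_left, period_apply]
  rfl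

/-- The number modulo `2` of elements of `A` at which `x` has the nontrivial sign. -/
def parity (x : HG Γ n) (A : Finset (Fin n)) : ZMod 2 :=
  ∑ i ∈ A, Multiplicative.toAdd (x.left i).2

theorem parity_eq_card (x : HG Γ n) (A : Finset (Fin n)) :
    parity x A = ((negSet x ∩ A).card : ZMod 2) := by
  have h : negSet x ∩ A = A.filter (fun i => (x.left i).2 ≠ 1) := by
    ext i; simp [negSet, and_comm]
  rw [h, Finset.card_filter, Nat.cast_sum, parity]
  refine Finset.sum_congr rfl fun i _ => ?_
  generalize (x.left i).2 = e
  revert e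
  decide

theorem cycleSign_eq_one_iff (x : HG Γ n) (q : Cycles x.right) :
    cycleSign x q = 1 ↔ parity x (cycleSupport x.right q) = 0 := by
  rw [parity_eq_card, cycleSign, ZMod.natCast_eq_zero_iff_even]
  rcases Nat.even_or_odd (negSet x ∩ cycleSupport x.right q).card with h | h
  · simp [h]
  · simp [h.neg_one_pow, Nat.not_even_iff_odd.2 h]

theorem parity_cycle (x : HG Γ n) (i : Fin n) :
    parity x (cycleSupport x.right (Quotient.mk _ i)) =
      Multiplicative.toAdd (holonomy x i).2 := by
  have key : ∀ k, Multiplicative.toAdd (coeff (x ^ k) i).2 =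
      ∑ l ∈ Finset.range k, Multiplicative.toAdd (x.left (x.right^[l] (x.right i))).2 := by
    intro k
    induction k with
    | zero => simp
    | succ k ih =>
      rw [coeff_pow_succ, Finset.sum_range_succ, Prod.snd_mul, toAdd_mul, ih, add_comm,
        coeff_iterate]
  rw [← mk_apply_eq, parity, cycleSupport_eq_image, Finset.sum_image (iterate_injOn _ _),
    period_apply, holonomy, key]

theorem cycleSign_mk_eq_one_iff (x : HG Γ n) (i : Fin n) :
    cycleSign x (Quotient.mk _ i) = 1 ↔ (holonomy x i).2 = 1 := by
  rw [cycleSign_eq_one_iff, parity_cycle]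
  exact toAdd_eq_zero

theorem z2_cases (a : Z2) : a = 1 ∨ a = Multiplicative.ofAdd 1 := by
  revert a; decide

theorem cycleSign_mk_eq_iff {x x' : HG Γ n} (i i' : Fin n) :
    cycleSign x (Quotient.mk _ i) = cycleSign x' (Quotient.mk _ i') ↔
      (holonomy x i).2 = (holonomy x' i').2 := by
  have h1 := cycleSign_mk_eq_one_iff x i
  have h2 := cycleSign_mk_eq_one_iff x' i'
  have h3 : (Multiplicative.ofAdd 1 : Z2) ≠ 1 := by decide
  rcases Int.units_eq_one_or (cycleSign x (Quotient.mk _ i)) with h | h <;>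
  rcases Int.units_eq_one_or (cycleSign x' (Quotient.mk _ i')) with h' | h' <;>
  rcases z2_cases (holonomy x i).2 with h4 | h4 <;>
  rcases z2_cases (holonomy x' i').2 with h5 | h5 <;>
  simp_all [h3.symm]

/-- The data attached to a cycle: its length, its sign and the class of its cycle-product. -/
noncomputable def cycleData (x : HG Γ n) (q : Cycles x.right) : ℕ × ℤˣ × ConjClasses Γ :=
  (cycleLength x.right q, cycleSign x q, cycleClass x q)

/-- Since $\mathbb Z_2$ is abelian, a conjugacy class of $\Gamma\times\mathbb Z_2$ is a class of
$\Gamma$ together with a sign. -/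
theorem cycleData_mk_eq_iff {x x' : HG Γ n} (i i' : Fin n) :
    cycleData x (Quotient.mk _ i) = cycleData x' (Quotient.mk _ i') ↔
      period x.right i = period x'.right i' ∧ IsConj (holonomy x i) (holonomy x' i') := by
  simp only [cycleData, Prod.mk.injEq, cycleLength_mk, cycleSign_mk_eq_iff, cycleClass_mk,
    ConjClasses.mk_eq_mk_iff_isConj]
  refine and_congr_right fun _ => ⟨?_, ?_⟩
  · rintro ⟨h1, h2⟩
    obtain ⟨c, hc⟩ := isConj_iff.1 h2
    refine isConj_iff.2 ⟨(c, 1), ?_⟩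
    ext1
    · simpa using hc
    · simpa using h1
  · intro h
    obtain ⟨c, hc⟩ := isConj_iff.1 h
    refine ⟨?_, isConj_iff.2 ⟨c.1, ?_⟩⟩
    · rw [← hc, snd_conj]
    · rw [← hc]; simp

/-! ### Types and conjugacy -/

theorem Ptn.ext {l l' : Ptn} (h : l.parts = l'.parts) : l = l' := by
  obtain ⟨m, p⟩ := l
  obtain ⟨m', p'⟩ := l'
  change p.parts = p'.parts at h
  obtain rfl : m = m' := by rw [← p.parts_sum, ← p'.parts_sum, h]
  rw [Nat.Partition.ext h]

open Classical in
theorem rho_parts (x : HG Γ n) (ε : ℤˣ) (c : ConjClasses Γ) :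
    (rho x ε c).parts = (Finset.univ.filter (fun q : Cycles x.right =>
      cycleSign x q = ε ∧ cycleClass x q = c)).val.map (cycleLength x.right) := rfl

theorem mem_rho_parts {x : HG Γ n} {ε : ℤˣ} {c : ConjClasses Γ} {m : ℕ} :
    m ∈ (rho x ε c).parts ↔ ∃ q : Cycles x.right, cycleData x q = (m, ε, c) := by
  classical
  rw [rho_parts, Multiset.mem_map]
  simp only [Finset.mem_val, Finset.mem_filter, Finset.mem_univ, true_and, cycleData,
    Prod.mk.injEq]
  exact exists_congr fun q => by tauto

open Classical in
theorem count_rho_parts (x : HG Γ n) (ε : ℤˣ) (c : ConjClasses Γ) (m : ℕ) :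
    (rho x ε c).parts.count m =
      Fintype.card {q : Cycles x.right // cycleData x q = (m, ε, c)} := by
  rw [rho_parts, Multiset.count_map, Fintype.card_subtype, ← Finset.filter_val, Finset.filter_filter,
    Finset.card_def]
  congr 2
  ext q
  simp only [Finset.mem_filter, Finset.mem_univ, true_and, cycleData, Prod.mk.injEq]
  tauto

theorem rho_eq_of_equiv {x x' : HG Γ n} (E : Cycles x.right ≃ Cycles x'.right)
    (hE : ∀ q, cycleData x' (E q) = cycleData x q) : rho x = rho x' := by
  classical
  funext ε c
  refine Ptn.ext (Multiset.ext.2 fun m => ?_)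
  rw [count_rho_parts, count_rho_parts]
  refine Fintype.card_congr (E.subtypeEquiv fun q => ?_)
  rw [hE]

/-- Multiplicities of parts count the cycles with given data; bijections between fibres of equal
size are glued. -/
theorem exists_equiv_of_rho_eq {x x' : HG Γ n} (h : rho x = rho x') :
    ∃ E : Cycles x.right ≃ Cycles x'.right, ∀ q, cycleData x' (E q) = cycleData x q := by
  classical
  have e : ∀ d, Nonempty ({q // cycleData x q = d} ≃ {q // cycleData x' q = d}) := by
    rintro ⟨m, ε, c⟩
    refine Fintype.card_eq.1 ?_
    rw [← count_rho_parts, ← count_rho_parts, h]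
  exact ⟨Equiv.ofFiberEquiv fun d => (e d).some, fun q => Equiv.ofFiberEquiv_map _ q⟩

theorem mem_classOfType_iff {x x' : HG Γ n} {ρpos ρneg : ConjClasses Γ → Ptn}
    (hx : x ∈ classOfType n ρpos ρneg) : x' ∈ classOfType n ρpos ρneg ↔ rho x = rho x' := by
  obtain ⟨rfl, rfl⟩ := hx
  constructor
  · rintro ⟨h1, h2⟩
    funext ε
    rcases Int.units_eq_one_or ε with rfl | rfl
    · exact h1.symm
    · exact h2.symm
  · intro h
    exact ⟨by rw [h], by rw [h]⟩

theorem cycleData_conj {x x' y : HG Γ n} (h : y * x = x' * y) (i : Fin n) :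
    cycleData x' (Quotient.mk _ (y.right i)) = cycleData x (Quotient.mk _ i) := by
  refine (cycleData_mk_eq_iff _ _).2 ⟨period_conj h i, IsConj.symm ?_⟩
  exact isConj_iff.2 ⟨coeff y i, (holonomy_conj h i).symm⟩

theorem rho_eq_of_isConj {x x' : HG Γ n} (h : IsConj x x') : rho x = rho x' := by
  obtain ⟨y, hy⟩ := isConj_iff.1 h
  have hy' : y * x = x' * y := by rw [← hy, inv_mul_cancel_right]
  have hr : ∀ j, y.right (x.right j) = x'.right (y.right j) := fun j =>
    Equiv.congr_fun (congrArg SemidirectProduct.right hy') j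
  have hs : x'.right = y.right * x.right * y.right⁻¹ := by
    rw [← hy]; rfl
  refine rho_eq_of_equiv (Quotient.congr y.right fun a b => ?_) fun q => ?_
  · change x.right.SameCycle a b ↔ x'.right.SameCycle (y.right a) (y.right b)
    rw [hs, Equiv.Perm.sameCycle_conj]
    simp
  · induction q using Quotient.inductionOn with
    | h i => exact cycleData_conj hy' i

/-- A bijection between cycles that respects the cycle data is induced by a conjugation. -/
theorem isConj_of_rho_eq {x x' : HG Γ n} (h : rho x = rho x') : IsConj x x' := by
  obtain ⟨E, hE⟩ := exists_equiv_of_rho_eq h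
  choose b hb using fun q : Cycles x.right => Quotient.exists_rep q
  choose b' hb' using fun q : Cycles x.right => Quotient.exists_rep (E q)
  have hdata : ∀ q, period x.right (b q) = period x'.right (b' q) ∧
      IsConj (holonomy x (b q)) (holonomy x' (b' q)) := fun q => by
    rw [← cycleData_mk_eq_iff, hb, hb', hE]
  have hk : ∀ i, ∃ k, x.right^[k] (b (Quotient.mk _ i)) = i := fun i =>
    exists_iterate_of_mk_eq (hb _)
  choose k hk using hk
  choose r hr using fun q => isConj_iff.1 (hdata q).2
  have hq : ∀ q l, (Quotient.mk _ (x.right^[l] (b q)) : Cycles x.right) = q := fun q l => by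
    rw [mk_iterate_eq, hb]
  have hkq : ∀ q l, x.right^[k (x.right^[l] (b q))] (b q) = x.right^[l] (b q) := fun q l => by
    have := hk (x.right^[l] (b q))
    rwa [hq] at this
  -- The conjugating permutation matches base points of corresponding cycles and is extended
  -- equivariantly along each cycle.
  let t : Fin n → Fin n := fun i => x'.right^[k i] (b' (Quotient.mk _ i))
  have ht : ∀ q l, t (x.right^[l] (b q)) = x'.right^[l] (b' q) := by
    intro q l
    change x'.right^[k (x.right^[l] (b q))] (b' (Quotient.mk _ (x.right^[l] (b q)))) = _
    rw [hq]
    exact (iterate_eq_iff (hdata q).1 _ _).1 (hkq q l)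
  have hinj : Function.Injective t := by
    intro i j hij
    have h1 : E (Quotient.mk _ i) = E (Quotient.mk _ j) := by
      have := congrArg (Quotient.mk (Equiv.Perm.SameCycle.setoid x'.right)) hij
      simp only [t] at this
      rwa [mk_iterate_eq, mk_iterate_eq, hb', hb'] at this
    have h2 := E.injective h1
    rw [← hk i, ← hk j, ← h2]
    refine (iterate_eq_iff (hdata _).1 _ _).2 ?_
    have := hij
    simp only [t] at this
    rwa [← h2] at this
  -- At the base point the coefficient is `r q`, which conjugates one holonomy to the other;
  -- elsewhere it is forced by $yx=x'y$.
  let C : Fin n → Γ × Z2 := fun i =>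
    coeff (x' ^ k i) (b' (Quotient.mk _ i)) * r (Quotient.mk _ i) *
      (coeff (x ^ k i) (b (Quotient.mk _ i)))⁻¹
  have hC : ∀ q l, C (x.right^[l] (b q)) =
      coeff (x' ^ l) (b' q) * r q * (coeff (x ^ l) (b q))⁻¹ := by
    intro q l
    -- Independence of the number of turns around the cycle: each turn multiplies by the two
    -- holonomies, which `r q` intertwines.
    have hper : ∀ l, coeff (x' ^ l) (b' q) * r q * (coeff (x ^ l) (b q))⁻¹ =
        coeff (x' ^ (l % period x.right (b q))) (b' q) * r q *
          (coeff (x ^ (l % period x.right (b q))) (b q))⁻¹ := by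
      intro l
      conv_lhs => rw [← Nat.mod_add_div l (period x.right (b q))]
      rw [coeff_pow_add_mul_period]
      nth_rewrite 2 [(hdata q).1]
      rw [coeff_pow_add_mul_period, ← hr q, conj_pow]
      group
    have hmod := (iterate_eq_iff_mod x.right (b q) _ _).1 (hkq q l)
    change coeff (x' ^ k (x.right^[l] (b q))) (b' (Quotient.mk _ (x.right^[l] (b q)))) *
      r (Quotient.mk _ (x.right^[l] (b q))) *
      (coeff (x ^ k (x.right^[l] (b q))) (b (Quotient.mk _ (x.right^[l] (b q)))))⁻¹ = _
    rw [hq, hper, hmod, ← hper]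
  let T : Equiv.Perm (Fin n) := Equiv.ofBijective t (Finite.injective_iff_bijective.1 hinj)
  let y : HG Γ n := ⟨fun i => C (T⁻¹ i), T⟩
  have hyr : ∀ i, y.right i = t i := fun i => rfl
  have hyc : ∀ i, coeff y i = C i := fun i => by
    change C (T⁻¹ (T i)) = C i
    simp
  have hy : y * x = x' * y := by
    refine hg_ext (fun i => ?_) fun i => ?_
    · obtain ⟨q, l, rfl⟩ : ∃ q l, i = x.right^[l] (b q) := ⟨_, _, (hk i).symm⟩
      rw [coeff_mul, coeff_mul, hyc, hyc, hyr, ht, hC, ← Function.iterate_succ_apply' x.right, hC,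
        coeff_pow_succ, coeff_pow_succ]
      group
    · obtain ⟨q, l, rfl⟩ : ∃ q l, i = x.right^[l] (b q) := ⟨_, _, (hk i).symm⟩
      change y.right (x.right _) = x'.right (y.right _)
      rw [hyr, hyr, ← Function.iterate_succ_apply' x.right, ht, ht, Function.iterate_succ_apply']
  exact isConj_iff.2 ⟨y, by rw [hy, mul_inv_cancel_right]⟩

theorem isConj_iff_rho_eq {x x' : HG Γ n} : IsConj x x' ↔ rho x = rho x' :=
  ⟨rho_eq_of_isConj, isConj_of_rho_eq⟩

end Holonomy

/-! ### Elements with prescribed cycles -/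

section Model

variable {Γ : Type*} [Group Γ] {n : ℕ} {ι : Type*} {len : ι → ℕ}

theorem finRotate_iterate {m : ℕ} (hm : 0 < m) (k : ℕ) (hk : k < m) :
    (finRotate m)^[k] ⟨0, hm⟩ = ⟨k, hk⟩ := by
  obtain ⟨m, rfl⟩ := Nat.exists_eq_succ_of_ne_zero hm.ne'
  induction k with
  | zero => rfl
  | succ k ih =>
    rw [Function.iterate_succ_apply', ih (by omega), finRotate_of_lt (by omega)]

theorem finRotate_iterate_self {m : ℕ} (hm : 0 < m) :
    (finRotate m)^[m] ⟨0, hm⟩ = ⟨0, hm⟩ := by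
  obtain ⟨m, rfl⟩ := Nat.exists_eq_succ_of_ne_zero hm.ne'
  rw [Function.iterate_succ_apply', finRotate_iterate _ m (by omega), finRotate_last']

/-- The element of the wreath product with cycles indexed by `ι`, of lengths `len i` and with
holonomies `val i`. -/
def model (e : (Sigma fun i => Fin (len i)) ≃ Fin n) (val : ι → Γ × Z2) : HG Γ n where
  left j := if ((e.symm j).2 : ℕ) = 0 then val (e.symm j).1 else 1
  right := e.permCongr (Equiv.sigmaCongrRight fun i => finRotate (len i))

variable (e : (Sigma fun i => Fin (len i)) ≃ Fin n) (val : ι → Γ × Z2) (hlen : ∀ i, 0 < len i)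

theorem model_right_iterate (k : ℕ) (i : ι) (a : Fin (len i)) :
    (model e val).right^[k] (e ⟨i, a⟩) = e ⟨i, (finRotate (len i))^[k] a⟩ := by
  induction k with
  | zero => rfl
  | succ k ih =>
    rw [Function.iterate_succ_apply', ih, Function.iterate_succ_apply']
    simp [model]

/-- The base point of the `i`-th cycle of the model. -/
def modelBase (i : ι) : Fin n := e ⟨i, ⟨0, hlen i⟩⟩

theorem modelBase_injective : Function.Injective (modelBase e hlen) := fun _ _ h =>
  congrArg Sigma.fst (e.injective h)

theorem model_iterate_base (i : ι) (k : ℕ) (hk : k < len i) :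
    (model e val).right^[k] (modelBase e hlen i) = e ⟨i, ⟨k, hk⟩⟩ := by
  rw [modelBase, model_right_iterate, finRotate_iterate]

theorem model_left_apply (p : Sigma fun i => Fin (len i)) :
    (model e val).left (e p) = if (p.2 : ℕ) = 0 then val p.1 else 1 := by
  change (if ((e.symm (e p)).2 : ℕ) = 0 then val (e.symm (e p)).1 else 1) = _
  rw [Equiv.symm_apply_apply]

theorem model_left_base (i : ι) : (model e val).left (modelBase e hlen i) = val i := by
  rw [modelBase, model_left_apply, if_pos rfl]

theorem model_left_of_ne (i : ι) (k : Fin (len i)) (hk : (k : ℕ) ≠ 0) :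
    (model e val).left (e ⟨i, k⟩) = 1 := by
  rw [model_left_apply, if_neg hk]

theorem model_period (i : ι) : period (model e val).right (modelBase e hlen i) = len i := by
  have hper : Function.IsPeriodicPt (model e val).right (len i) (modelBase e hlen i) := by
    rw [Function.IsPeriodicPt, Function.IsFixedPt, modelBase, model_right_iterate,
      finRotate_iterate_self]
  refine le_antisymm (hper.minimalPeriod_le (hlen i)) (not_lt.1 fun hlt => ?_)
  have h1 := iterate_period (model e val).right (modelBase e hlen i)
  rw [model_iterate_base e val hlen i _ hlt] at h1
  have h2 := eq_of_heq (Sigma.mk.inj (e.injective h1)).2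
  exact (period_pos _ _).ne' (congrArg Fin.val h2)

/-- The only nontrivial entry of the cycle sits at the base point, and is met only on the last step,
when the cycle closes. -/
theorem model_holonomy (i : ι) : holonomy (model e val) (modelBase e hlen i) = val i := by
  have h : ∀ k < len i, coeff (model e val ^ k) (modelBase e hlen i) = 1 := by
    intro k
    induction k with
    | zero => simp
    | succ k ih =>
      intro hk
      rw [coeff_pow_succ, ih (by omega), mul_one, coeff, ← Function.iterate_succ_apply'
        (model e val).right, model_iterate_base e val hlen i _ hk]
      exact model_left_of_ne e val i _ (by simp)
  rw [holonomy, model_period]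
  obtain ⟨m, hm⟩ := Nat.exists_eq_succ_of_ne_zero (hlen i).ne'
  have hb : (model e val).right^[m + 1] (modelBase e hlen i) = modelBase e hlen i := by
    have := iterate_period (model e val).right (modelBase e hlen i)
    rwa [model_period, hm] at this
  rw [hm, coeff_pow_succ, h m (by omega), mul_one, coeff, ← Function.iterate_succ_apply'
    (model e val).right, hb, model_left_base]

theorem model_cycles_bijective :
    Function.Bijective (fun i => (Quotient.mk _ (modelBase e hlen i) :
      Cycles (model e val).right)) := by
  constructor
  · intro i j h
    obtain ⟨k, hk⟩ := exists_iterate_of_mk_eq h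
    rw [modelBase, model_right_iterate] at hk
    exact congrArg Sigma.fst (e.injective hk)
  · intro q
    obtain ⟨j, rfl⟩ := Quotient.exists_rep q
    obtain ⟨⟨i, k, hk⟩, rfl⟩ := e.surjective j
    refine ⟨i, ?_⟩
    change Quotient.mk _ _ = _
    rw [← mk_iterate_eq _ k, model_iterate_base e val hlen i k hk]

/-- The element of `ℤ_2` that corresponds to a sign. -/
def signToZ2 (ε : ℤˣ) : Z2 := if ε = 1 then 1 else Multiplicative.ofAdd 1

theorem model_cycleData (i : ι) (γ : Γ) (ε : ℤˣ) (h : val i = (γ, signToZ2 ε)) :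
    cycleData (model e val) (Quotient.mk _ (modelBase e hlen i)) =
      (len i, ε, ConjClasses.mk γ) := by
  simp only [cycleData, Prod.mk.injEq, cycleLength_mk, model_period, cycleClass_mk,
    model_holonomy, h, true_and, and_true]
  have h1 := cycleSign_mk_eq_one_iff (model e val) (modelBase e hlen i)
  rw [model_holonomy, h] at h1
  have h3 : (Multiplicative.ofAdd 1 : Z2) ≠ 1 := by decide
  rcases Int.units_eq_one_or (cycleSign (model e val) (Quotient.mk _ (modelBase e hlen i))) with
    h2 | h2 <;> rcases Int.units_eq_one_or ε with h' | h' <;> simp_all [signToZ2]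

open Classical in
theorem model_rho_parts (hlen : ∀ i, 0 < len i) [Fintype ι] (γ : ι → Γ) (ε : ι → ℤˣ)
    (h : ∀ i, val i = (γ i, signToZ2 (ε i))) (δ : ℤˣ) (c : ConjClasses Γ) :
    (rho (model e val) δ c).parts =
      (Finset.univ.filter (fun i => ε i = δ ∧ ConjClasses.mk (γ i) = c)).val.map len := by
  refine Multiset.ext.2 fun m => ?_
  rw [count_rho_parts, Multiset.count_map, ← Finset.filter_val, Finset.filter_filter,
    ← Finset.card_def, ← Fintype.card_subtype]
  refine Fintype.card_congr (Equiv.symm ((Equiv.ofBijective _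
    (model_cycles_bijective e val hlen)).subtypeEquiv fun i => ?_))
  rw [Equiv.ofBijective_apply, model_cycleData e val hlen i _ _ (h i)]
  simp only [Prod.mk.injEq]
  tauto

/-- A permutation of the cycles of the model that respects their lengths. -/
def modelPerm (σ : Equiv.Perm ι) (hσ : ∀ i, len (σ i) = len i) : Equiv.Perm (Fin n) :=
  e.permCongr
    { toFun := fun p => ⟨σ p.1, Fin.cast (hσ p.1).symm p.2⟩
      invFun := fun p => ⟨σ.symm p.1, Fin.cast (by rw [← hσ (σ.symm p.1), Equiv.apply_symm_apply]) p.2⟩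
      left_inv := fun ⟨i, k⟩ => by
        refine Sigma.ext (by simp) ?_
        rw [Fin.heq_ext_iff (by simp)]
        rfl
      right_inv := fun ⟨i, k⟩ => by
        refine Sigma.ext (by simp) ?_
        rw [Fin.heq_ext_iff (by simp)]
        rfl }

theorem modelPerm_apply (σ : Equiv.Perm ι) (hσ : ∀ i, len (σ i) = len i) (i : ι)
    (k : Fin (len i)) :
    modelPerm e σ hσ (e ⟨i, k⟩) = e ⟨σ i, Fin.cast (hσ i).symm k⟩ := by
  simp [modelPerm]

theorem modelPerm_base (σ : Equiv.Perm ι) (hσ : ∀ i, len (σ i) = len i) (i : ι) :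
    modelPerm e σ hσ (modelBase e hlen i) = modelBase e hlen (σ i) := by
  rw [modelBase, modelPerm_apply]
  rfl

theorem finRotate_cast {m m' : ℕ} (h : m = m') (k : Fin m) :
    Fin.cast h (finRotate m k) = finRotate m' (Fin.cast h k) := by
  subst h; rfl

/-- The entries of the model depend only on `val` and the position within a cycle, so a permutation
of cycles preserving lengths and values is a symmetry. -/
theorem modelPerm_comm (σ : Equiv.Perm ι) (hσ : ∀ i, len (σ i) = len i)
    (hval : ∀ i, val (σ i) = val i) :
    (SemidirectProduct.inr (modelPerm e σ hσ) : HG Γ n) * model e val =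
      model e val * SemidirectProduct.inr (modelPerm e σ hσ) := by
  have hc : ∀ (s : Equiv.Perm (Fin n)) j, coeff (SemidirectProduct.inr s : HG Γ n) j = 1 :=
    fun s j => rfl
  have hright : ∀ j, modelPerm e σ hσ ((model e val).right j) =
      (model e val).right (modelPerm e σ hσ j) := by
    intro j
    obtain ⟨⟨i, k⟩, rfl⟩ := e.surjective j
    have h1 := fun k => model_right_iterate e val 1 i k
    have h2 := fun k => model_right_iterate e val 1 (σ i) k
    simp only [Function.iterate_one] at h1 h2
    rw [h1, modelPerm_apply, modelPerm_apply, h2, finRotate_cast]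
  refine hg_ext (fun j => ?_) hright
  rw [coeff_mul, coeff_mul, hc, hc, one_mul, mul_one, SemidirectProduct.right_inr, coeff, coeff,
    ← hright]
  obtain ⟨⟨i, k⟩, hj⟩ := e.surjective ((model e val).right j)
  rw [← hj, modelPerm_apply, model_left_apply, model_left_apply]
  simp [hval]

end Model

/-! ### Realizing every type of total size `n` -/

section Realization

variable {Γ : Type*} [Group Γ] {n : ℕ}

/-- The multiset of the lengths of the cycles of given sign and class. -/
def typeParts (ρpos ρneg : ConjClasses Γ → Ptn) (p : ℤˣ × ConjClasses Γ) : Multiset ℕ :=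
  if p.1 = 1 then (ρpos p.2).parts else (ρneg p.2).parts

/-- The index set of the cycles of an element of given type. -/
abbrev TypeIndex (ρpos ρneg : ConjClasses Γ → Ptn) : Type _ :=
  Σ p : ℤˣ × ConjClasses Γ, (typeParts ρpos ρneg p).ToType

theorem typeIndex_len_pos (ρpos ρneg : ConjClasses Γ → Ptn) (i : TypeIndex ρpos ρneg) :
    0 < (i.2 : ℕ) := by
  obtain ⟨⟨ε, c⟩, m⟩ := i
  have hm : (m : ℕ) ∈ typeParts ρpos ρneg (ε, c) := Multiset.coe_mem
  change 0 < (m : ℕ)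
  generalize (m : ℕ) = k at hm
  rw [typeParts] at hm
  split_ifs at hm
  · exact (ρpos c).2.parts_pos hm
  · exact (ρneg c).2.parts_pos hm

theorem exists_typeIndex_equiv [Finite Γ] {ρpos ρneg : ConjClasses Γ → Ptn}
    (hn : normSize ρpos + normSize ρneg = n) :
    Nonempty ((Σ i : TypeIndex ρpos ρneg, Fin (i.2 : ℕ)) ≃ Fin n) := by
  classical
  have := Fintype.ofFinite (ConjClasses Γ)
  refine ⟨Fintype.equivFinOfCardEq ?_⟩
  have hsum : ∀ m : Multiset ℕ, ∑ x : m.ToType, (x : ℕ) = m.sum := fun m =>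
    congrArg Multiset.sum (Multiset.map_univ_coe m)
  rw [Fintype.card_sigma, Fintype.sum_sigma]
  simp only [Fintype.card_fin, hsum, Fintype.sum_prod_type]
  rw [UnitsInt.univ, Finset.sum_pair (by decide), ← hn, normSize, normSize,
    finsum_eq_sum_of_fintype, finsum_eq_sum_of_fintype]
  congr 1 <;> refine Finset.sum_congr rfl fun c _ => ?_
  · exact (ρpos c).2.parts_sum
  · exact (ρneg c).2.parts_sum

/-- The holonomies of the cycles of an element of given type. -/
noncomputable def typeVal {ρpos ρneg : ConjClasses Γ → Ptn} (i : TypeIndex ρpos ρneg) : Γ × Z2 :=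
  (Function.surjInv ConjClasses.mk_surjective i.1.2, signToZ2 i.1.1)

theorem model_mem_classOfType [Finite Γ] {ρpos ρneg : ConjClasses Γ → Ptn}
    (e : (Σ i : TypeIndex ρpos ρneg, Fin (i.2 : ℕ)) ≃ Fin n) :
    model e typeVal ∈ classOfType n ρpos ρneg := by
  classical
  have := Fintype.ofFinite (ConjClasses Γ)
  have key : ∀ ε c, (rho (model e typeVal) ε c).parts = typeParts ρpos ρneg (ε, c) := by
    intro ε c
    rw [model_rho_parts e typeVal (typeIndex_len_pos ρpos ρneg) 
      (fun i => Function.surjInv ConjClasses.mk_surjective i.1.2) (fun i => i.1.1) (fun i => rfl)]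
    have hf : (Finset.univ.filter (fun i : TypeIndex ρpos ρneg =>
        i.1.1 = ε ∧ ConjClasses.mk (Function.surjInv ConjClasses.mk_surjective i.1.2) = c)) =
        (Finset.univ : Finset (typeParts ρpos ρneg (ε, c)).ToType).map
          (Function.Embedding.sigmaMk (β := fun p => (typeParts ρpos ρneg p).ToType) (ε, c)) := by
      ext ⟨⟨ε', c'⟩, m⟩
      have hc : ConjClasses.mk (Function.surjInv ConjClasses.mk_surjective c') = c' :=
        Function.surjInv_eq _ c'
      simp only [Finset.mem_filter, Finset.mem_univ, true_and, hc, Finset.mem_map,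
        Function.Embedding.sigmaMk_apply]
      constructor
      · rintro ⟨rfl, rfl⟩
        exact ⟨m, rfl⟩
      · rintro ⟨m', h⟩
        have := congrArg Sigma.fst h
        simp only [Prod.mk.injEq] at this
        exact ⟨this.1.symm, this.2.symm⟩
    rw [hf, Finset.map_val, Multiset.map_map]
    exact Multiset.map_univ_coe _
  refine ⟨?_, ?_⟩ <;> funext c <;> refine Ptn.ext ?_ <;> rw [key] <;> rfl

theorem classOfType_nonempty [Finite Γ] {ρpos ρneg : ConjClasses Γ → Ptn}
    (hn : normSize ρpos + normSize ρneg = n) : (classOfType n ρpos ρneg).Nonempty :=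
  let ⟨e⟩ := exists_typeIndex_equiv hn
  ⟨_, model_mem_classOfType e⟩

end Realization

/-! ### The double cover -/

section Cover

variable {Γ : Type*} [Group Γ] {n : ℕ}

/-- The central element `z ^ e` of the double cover. -/
def zCover (Γ : Type*) [Group Γ] (n : ℕ) (e : ZMod 2) : BG Γ n :=
  SemidirectProduct.inl (1, zPow n e)

theorem bg_ext {X Y : BG Γ n} (h1 : X.left.1 = Y.left.1) (h2 : X.left.2 = Y.left.2)
    (h3 : X.right = Y.right) : X = Y :=
  SemidirectProduct.ext (Prod.ext h1 h2) h3

@[simp] theorem zCover_mul_left_fst (e : ZMod 2) (X : BG Γ n) :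
    (zCover Γ n e * X).left.1 = X.left.1 := by
  simp [zCover]

@[simp] theorem zCover_mul_left_snd (e : ZMod 2) (X : BG Γ n) :
    (zCover Γ n e * X).left.2 = zPow n e * X.left.2 := by
  simp [zCover]

@[simp] theorem zCover_mul_right (e : ZMod 2) (X : BG Γ n) :
    (zCover Γ n e * X).right = X.right := by
  simp [zCover]

@[simp] theorem mul_left_fst (X Y : BG Γ n) :
    (X * Y).left.1 = X.left.1 * permAction Γ n X.right Y.left.1 := rfl

@[simp] theorem mul_left_snd (X Y : BG Γ n) :
    (X * Y).left.2 = X.left.2 * piAction n X.right Y.left.2 := rfl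

theorem zCover_comm (e : ZMod 2) (X : BG Γ n) : zCover Γ n e * X = X * zCover Γ n e := by
  refine bg_ext ?_ ?_ ?_
  · rw [zCover_mul_left_fst, mul_left_fst]
    simp [zCover]
  · rw [zCover_mul_left_snd, mul_left_snd]
    simp [zCover, zPow_comm]
  · simp [zCover]

@[simp] theorem zCover_zero : zCover Γ n 0 = 1 := by
  rw [zCover, zPow_zero]
  exact map_one _

theorem zCover_add (e f : ZMod 2) : zCover Γ n (e + f) = zCover Γ n e * zCover Γ n f := by
  rw [zCover, zPow_add, zCover, zCover, ← map_mul, Prod.mk_mul_mk, one_mul]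

theorem zCover_one_ne_one : zCover Γ n 1 ≠ 1 := by
  intro h
  have := congrArg (fun X => X.left.2) h
  exact zGen_ne_one n (by simpa [zCover] using this)

theorem theta_right (X : BG Γ n) : (theta Γ n X).right = X.right := rfl

theorem theta_left (X : BG Γ n) (i : Fin n) :
    (theta Γ n X).left i = (X.left.1 i, Multiplicative.ofAdd (piVec X.left.2 i)) := rfl

@[simp] theorem theta_zCover (e : ZMod 2) : theta Γ n (zCover Γ n e) = 1 := by
  refine SemidirectProduct.ext (funext fun i => ?_) rfl
  rw [theta_left]
  simp only [zCover, SemidirectProduct.left_inl, piVec_zPow]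
  rfl

theorem theta_surjective : Function.Surjective (theta Γ n) := by
  intro x
  obtain ⟨u, hu⟩ := piVec_surjective fun i => Multiplicative.toAdd (x.left i).2
  refine ⟨⟨(fun i => (x.left i).1, u), x.right⟩, SemidirectProduct.ext (funext fun i => ?_) rfl⟩
  rw [theta_left]
  simp [hu]

theorem exists_zCover_mul {X Y : BG Γ n} (h : theta Γ n X = theta Γ n Y) :
    ∃ e, X = zCover Γ n e * Y := by
  have hl := fun i => congrFun (congrArg SemidirectProduct.left h) i
  simp only [theta_left, Prod.mk.injEq] at hl
  obtain ⟨e, he⟩ := eq_zPow_mul_of_piVec_eq fun i => Multiplicative.ofAdd.injective (hl i).2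
  refine ⟨e, bg_ext ?_ ?_ ?_⟩
  · rw [zCover_mul_left_fst]
    exact funext fun i => (hl i).1
  · rw [zCover_mul_left_snd, he]
  · rw [zCover_mul_right]
    exact congrArg (fun w : HG Γ n => w.right) h

theorem isConj_zCover_of_comm {X Y : BG Γ n} (h : Y * X = zCover Γ n 1 * (X * Y)) :
    IsConj X (zCover Γ n 1 * X) :=
  isConj_iff.2 ⟨Y, by rw [h, mul_assoc, mul_inv_cancel_right]⟩

/-- A class splits if and only if a lift of one of its elements is not conjugate to its product
with `z`. -/
theorem splits_iff {ρpos ρneg : ConjClasses Γ → Ptn} {X : BG Γ n}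
    (hX : theta Γ n X ∈ classOfType n ρpos ρneg) :
    Splits (classOfType n ρpos ρneg) ↔ ¬ IsConj X (zCover Γ n 1 * X) := by
  -- The preimage is always the union of the classes of $X$ and $zX$; only their distinctness is at
  -- issue.
  have hmem : ∀ Y, Y ∈ theta Γ n ⁻¹' classOfType n ρpos ρneg ↔
      IsConj X Y ∨ IsConj (zCover Γ n 1 * X) Y := by
    intro Y
    rw [Set.mem_preimage, mem_classOfType_iff hX, ← isConj_iff_rho_eq]
    constructor
    · intro h
      obtain ⟨g, hg⟩ := isConj_iff.1 h
      obtain ⟨G, rfl⟩ := theta_surjective g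
      rw [← map_mul, ← map_inv, ← map_mul] at hg
      obtain ⟨e, he⟩ := exists_zCover_mul hg.symm
      rcases zmod_two_cases e with rfl | rfl
      · exact Or.inl (isConj_iff.2 ⟨G, by rw [he, zCover_zero, one_mul]⟩)
      · refine Or.inr (isConj_iff.2 ⟨G, ?_⟩)
        rw [he, ← mul_assoc, ← zCover_comm, mul_assoc, mul_assoc, mul_assoc]
    · rintro (h | h)
      · exact (theta Γ n).map_isConj h
      · simpa using (theta Γ n).map_isConj h
  constructor
  · rintro ⟨D₁, D₂, hne, hD⟩ hconj
    have hall : ∀ Y ∈ theta Γ n ⁻¹' classOfType n ρpos ρneg,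
        ConjClasses.mk Y = ConjClasses.mk X := by
      intro Y hY
      refine ConjClasses.mk_eq_mk_iff_isConj.2 ?_
      rcases (hmem Y).1 hY with h | h
      · exact h.symm
      · exact (hconj.trans h).symm
    refine hne ?_
    obtain ⟨Y₁, rfl⟩ := ConjClasses.exists_rep D₁
    obtain ⟨Y₂, rfl⟩ := ConjClasses.exists_rep D₂
    rw [hall Y₁ (hD ▸ Or.inl ConjClasses.mem_carrier_mk),
      hall Y₂ (hD ▸ Or.inr ConjClasses.mem_carrier_mk)]
  · intro h
    refine ⟨ConjClasses.mk X, ConjClasses.mk (zCover Γ n 1 * X),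
      fun h' => h (ConjClasses.mk_eq_mk_iff_isConj.1 h'), Set.ext fun Y => ?_⟩
    rw [hmem, Set.mem_union, ConjClasses.mem_carrier_iff_mk_eq, ConjClasses.mem_carrier_iff_mk_eq,
      ConjClasses.mk_eq_mk_iff_isConj, ConjClasses.mk_eq_mk_iff_isConj, isConj_comm (g := Y),
      isConj_comm (g := Y)]

theorem piDeg_eq_parity (X : BG Γ n) :
    piDeg X.left.2 = parity (theta Γ n X) Finset.univ := rfl

/-! ### Elements with disjoint supports -/

/-- The element `x` is trivial at the point `i`. -/
def TrivialAt (x : HG Γ n) (i : Fin n) : Prop := x.left i = 1 ∧ x.right i = i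

theorem piVec_eq_zero_of_trivialAt {X : BG Γ n} {i : Fin n} (h : TrivialAt (theta Γ n X) i) :
    piVec X.left.2 i = 0 := by
  have := h.1
  rw [theta_left] at this
  exact Multiplicative.ofAdd.injective (congrArg Prod.snd this)

theorem fst_eq_one_of_trivialAt {X : BG Γ n} {i : Fin n} (h : TrivialAt (theta Γ n X) i) :
    X.left.1 i = 1 :=
  congrArg Prod.fst h.1

/-- The permutation of `X` moves only points where the entries of `Y` are trivial, so the action
disappears from the product. -/
theorem mul_left_of_disjoint {X Y : BG Γ n}
    (h : ∀ i, TrivialAt (theta Γ n X) i ∨ TrivialAt (theta Γ n Y) i) :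
    (X * Y).left.1 = X.left.1 * Y.left.1 ∧ (X * Y).left.2 = X.left.2 * Y.left.2 := by
  constructor
  · rw [mul_left_fst]
    congr 1
    funext i
    change Y.left.1 (X.right⁻¹ i) = Y.left.1 i
    by_cases hi : X.right i = i
    · rw [Equiv.Perm.inv_eq_iff_eq.2 hi.symm]
    · have h1 := (h i).resolve_left fun h' => hi h'.2
      have h2 := (h (X.right⁻¹ i)).resolve_left fun h' => hi (by
        have := h'.2
        rw [theta_right, Equiv.Perm.coe_inv, Equiv.apply_symm_apply] at this
        exact Equiv.Perm.eq_inv_iff_eq.1 this)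
      rw [fst_eq_one_of_trivialAt h1, fst_eq_one_of_trivialAt h2]
  · have hfix : ∀ i, piVec Y.left.2 i ≠ 0 → X.right i = i := fun i hi =>
      ((h i).resolve_right fun h' => hi (piVec_eq_zero_of_trivialAt h')).2
    rw [mul_left_snd, piAction_eq_self hfix]

/-- In the commutation rule of $\Pi_n$ the dot product vanishes, which leaves the product of the
degrees. -/
theorem mul_comm_of_disjoint {X Y : BG Γ n}
    (h : ∀ i, TrivialAt (theta Γ n X) i ∨ TrivialAt (theta Γ n Y) i) :
    X * Y = zCover Γ n (piDeg X.left.2 * piDeg Y.left.2) * (Y * X) := by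
  have h1 := mul_left_of_disjoint h
  have h2 := mul_left_of_disjoint fun i => (h i).symm
  refine bg_ext ?_ ?_ ?_
  · rw [zCover_mul_left_fst, h1.1, h2.1]
    funext i
    rcases h i with h' | h' <;> simp [fst_eq_one_of_trivialAt h']
  · rw [zCover_mul_left_snd, h1.2, h2.2, piGroup_comm]
    congr 2
    rw [Finset.sum_eq_zero, add_zero]
    intro i _
    rcases h i with h' | h' <;> simp [piVec_eq_zero_of_trivialAt h']
  · rw [zCover_mul_right]
    refine Equiv.Perm.Disjoint.commute fun i => ?_
    exact (h i).imp (fun h' => h'.2) fun h' => h'.2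

theorem hg_mul_comm_of_disjoint {x y : HG Γ n} (h : ∀ i, TrivialAt x i ∨ TrivialAt y i) :
    x * y = y * x := by
  obtain ⟨X, rfl⟩ := theta_surjective x
  obtain ⟨Y, rfl⟩ := theta_surjective y
  rw [← map_mul, mul_comm_of_disjoint h, map_mul, theta_zCover, one_mul, map_mul]

/-- The restriction of `x` to an invariant set of points. -/
def restrict (x : HG Γ n) (A : Finset (Fin n)) (hA : ∀ i, x.right i ∈ A ↔ i ∈ A) : HG Γ n where
  left i := if i ∈ A then x.left i else 1
  right :=
    { toFun := fun i => if i ∈ A then x.right i else i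
      invFun := fun i => if i ∈ A then x.right⁻¹ i else i
      left_inv := fun i => by
        by_cases h : i ∈ A
        · simp [h, hA]
        · simp [h]
      right_inv := fun i => by
        have h' : x.right⁻¹ i ∈ A ↔ i ∈ A := by rw [← hA, Equiv.Perm.coe_inv, Equiv.apply_symm_apply]
        by_cases h : i ∈ A
        · simp only [h, if_true, Equiv.Perm.coe_inv, Equiv.apply_symm_apply] at h' ⊢
          simp [h']
        · simp [h] }

/-! ### Cutting an element along an invariant set of points -/

section Restrict

variable {x : HG Γ n} {A : Finset (Fin n)}

theorem compl_invariant (hA : ∀ i, x.right i ∈ A ↔ i ∈ A) (i : Fin n) :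
    x.right i ∈ Aᶜ ↔ i ∈ Aᶜ := by
  rw [Finset.mem_compl, Finset.mem_compl, hA]

variable (hA : ∀ i, x.right i ∈ A ↔ i ∈ A)

theorem restrict_right_apply (i : Fin n) :
    (restrict x A hA).right i = if i ∈ A then x.right i else i := rfl

theorem restrict_coeff (i : Fin n) :
    coeff (restrict x A hA) i = if i ∈ A then coeff x i else 1 := by
  rw [coeff, restrict_right_apply]
  by_cases h : i ∈ A
  · simp [restrict, h, hA, coeff]
  · simp [restrict, h]

theorem restrict_trivialAt {i : Fin n} (h : i ∉ A) : TrivialAt (restrict x A hA) i :=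
  ⟨by simp [restrict, h], by simp [restrict_right_apply, h]⟩

theorem restrict_parity : parity (restrict x A hA) Finset.univ = parity x A := by
  rw [parity, parity, ← Finset.sum_filter_add_sum_filter_not Finset.univ (· ∈ A)]
  rw [Finset.sum_eq_zero (s := Finset.univ.filter (· ∉ A)), add_zero]
  · rw [Finset.filter_univ_mem]
    exact Finset.sum_congr rfl fun i hi => by simp [restrict, hi]
  · intro i hi
    have := (Finset.mem_filter.1 hi).2
    simp [restrict, this]

theorem restrict_mul_restrict_compl :
    restrict x A hA * restrict x Aᶜ (compl_invariant hA) = x := by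
  refine hg_ext (fun i => ?_) fun i => ?_
  · rw [coeff_mul, restrict_coeff, restrict_coeff, restrict_right_apply]
    by_cases h : i ∈ A <;> simp [h, hA]
  · rw [SemidirectProduct.mul_right, Equiv.Perm.mul_apply, restrict_right_apply,
      restrict_right_apply]
    by_cases h : i ∈ A <;> simp [h, hA]

theorem restrict_disjoint (i : Fin n) :
    TrivialAt (restrict x A hA) i ∨ TrivialAt (restrict x Aᶜ (compl_invariant hA)) i := by
  by_cases h : i ∈ A
  · exact Or.inr (restrict_trivialAt _ (by simpa using h))
  · exact Or.inl (restrict_trivialAt _ h)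

theorem restrict_comm_self : restrict x A hA * x = x * restrict x A hA := by
  have h := hg_mul_comm_of_disjoint (restrict_disjoint hA)
  calc restrict x A hA * x
      = restrict x A hA * (restrict x A hA * restrict x Aᶜ (compl_invariant hA)) := by
        rw [restrict_mul_restrict_compl]
    _ = restrict x A hA * restrict x Aᶜ (compl_invariant hA) * restrict x A hA := by
        rw [mul_assoc, ← h]
    _ = x * restrict x A hA := by rw [restrict_mul_restrict_compl]

/-- The commutation rule between a lift of `x` and a lift of a restriction of `x`. -/
theorem lift_restrict_comm {X R : BG Γ n} (hX : theta Γ n X = x)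
    (hR : theta Γ n R = restrict x A hA) :
    R * X = zCover Γ n (parity x A * parity x Aᶜ) * (X * R) := by
  -- $X$ factors as $R\cdot R^{-1}X$, and the second factor lifts the complementary restriction.
  have hR' : theta Γ n (R⁻¹ * X) = restrict x Aᶜ (compl_invariant hA) := by
    rw [map_mul, map_inv, hR, hX, inv_mul_eq_iff_eq_mul, restrict_mul_restrict_compl]
  have h := mul_comm_of_disjoint (X := R) (Y := R⁻¹ * X) fun i => by
    rw [hR, hR']; exact restrict_disjoint hA i
  rw [piDeg_eq_parity, piDeg_eq_parity, hR, hR', restrict_parity, restrict_parity,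
    mul_inv_cancel_left] at h
  conv_lhs => rw [h]
  rw [← mul_assoc R, ← zCover_comm, mul_assoc, ← mul_assoc R, mul_inv_cancel_left]

end Restrict

theorem parity_add_compl (x : HG Γ n) (A : Finset (Fin n)) :
    parity x A + parity x Aᶜ = parity x Finset.univ :=
  Finset.sum_add_sum_compl A _

theorem cycleSupport_invariant (s : Equiv.Perm (Fin n)) (q : Cycles s) (i : Fin n) :
    s i ∈ cycleSupport s q ↔ i ∈ cycleSupport s q := by
  rw [mem_cycleSupport, mem_cycleSupport, mk_apply_eq]

/-! ### Classes that do not split -/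

theorem parity_eq_one_of_cycleSign {x : HG Γ n} {q : Cycles x.right} (h : cycleSign x q = -1) :
    parity x (cycleSupport x.right q) = 1 := by
  refine (zmod_two_cases _).resolve_left fun h' => ?_
  rw [(cycleSign_eq_one_iff x q).2 h'] at h
  exact absurd h (by decide)

/-- A negative cycle of an even element prevents splitting. -/
theorem isConj_of_neg_cycle {X : BG Γ n} (hX : parity (theta Γ n X) Finset.univ = 0)
    {q : Cycles (theta Γ n X).right} (hq : cycleSign (theta Γ n X) q = -1) :
    IsConj X (zCover Γ n 1 * X) := by
  have hA := cycleSupport_invariant _ q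
  obtain ⟨R, hR⟩ := theta_surjective (restrict (theta Γ n X) _ hA)
  have h := lift_restrict_comm hA rfl hR
  have h1 := parity_eq_one_of_cycleSign hq
  have h2 := parity_add_compl (theta Γ n X) (cycleSupport _ q)
  rw [h1, hX] at h2
  -- The total is even and the cycle is odd, so the complement is odd too.
  have h3 : parity (theta Γ n X) (cycleSupport (theta Γ n X).right q)ᶜ = 1 := by
    generalize parity (theta Γ n X) (cycleSupport (theta Γ n X).right q)ᶜ = e at h2
    revert e; decide
  rw [h1, h3, mul_one] at h
  exact isConj_zCover_of_comm h

/-- A positive cycle of length `m + 1` prevents splitting if the element is odd or `m` is odd. -/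
theorem isConj_of_pos_cycle {X : BG Γ n} {q : Cycles (theta Γ n X).right}
    (hq : cycleSign (theta Γ n X) q = 1) {m : ℕ} (hm : cycleLength (theta Γ n X).right q = m + 1)
    (hX : (m : ZMod 2) + (m + 1) * parity (theta Γ n X) Finset.univ = 1) :
    IsConj X (zCover Γ n 1 * X) := by
  obtain ⟨j, rfl⟩ := Quotient.exists_rep q
  set s := (theta Γ n X).right with hs
  have hper : period s j = m + 1 := by rw [← hm, cycleLength_mk]
  set tl := (List.range m).map (fun k => s^[k + 1] j) with htl
  have hl : j :: tl = (List.range (m + 1)).map (fun k => s^[k] j) := by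
    rw [List.range_succ_eq_map, List.map_cons, List.map_map]
    rfl
  have hrot : (j :: tl).map s = tl ++ [j] := by
    have hj : s^[m + 1] j = j := by rw [← hper, iterate_period]
    rw [hl, List.map_map, List.range_succ, List.map_append, htl]
    congr 1
    · exact List.map_congr_left fun k _ => (Function.iterate_succ_apply' s k j).symm
    · simp only [List.map_cons, List.map_nil, Function.comp_apply]
      rw [← Function.iterate_succ_apply' s, hj]
  have hnodup : (j :: tl).Nodup := by
    rw [hl]
    refine List.Nodup.map_on (fun k hk l hl' h => ?_) List.nodup_range
    refine iterate_injOn s j ?_ ?_ h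
    · simpa [hper] using hk
    · simpa [hper] using hl'
  have hmem : ∀ i, i ∈ j :: tl ↔ i ∈ cycleSupport s (Quotient.mk _ j) := by
    intro i
    rw [hl, cycleSupport_eq_image, hper, List.mem_map, Finset.mem_image]
    simp only [List.mem_range, Finset.mem_range]
  have hlen : tl.length = m := by simp [htl]
  set a := aProd (j :: tl) with ha
  have hsa : piAction n X.right a = zPow n m * a := by
    rw [ha, piAction_aProd]
    change aProd ((j :: tl).map s) = _
    rw [hrot, aProd_rotate (List.nodup_cons.1 hnodup).1, hlen]
  -- The dot product counts the signs on the support of the cycle, which is positive.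
  have hdot : ∑ i, piVec a i * piVec X.left.2 i = 0 := by
    have h0 := (cycleSign_eq_one_iff _ _).1 hq
    rw [← h0, parity, ← Finset.sum_subset (Finset.subset_univ (cycleSupport s (Quotient.mk _ j)))]
    · refine Finset.sum_congr rfl fun i hi => ?_
      rw [ha, piVec_aProd, List.count_eq_one_of_mem hnodup ((hmem i).2 hi), Nat.cast_one, one_mul]
      rfl
    · intro i _ hi
      rw [ha, piVec_aProd, List.count_eq_zero_of_not_mem (fun h => hi ((hmem i).1 h)),
        Nat.cast_zero, zero_mul]
  refine isConj_zCover_of_comm (Y := SemidirectProduct.inl (1, a)) (bg_ext ?_ ?_ ?_)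
  · rw [zCover_mul_left_fst, mul_left_fst, mul_left_fst]
    simp
  · rw [zCover_mul_left_snd, mul_left_snd, mul_left_snd]
    simp only [SemidirectProduct.left_inl, SemidirectProduct.right_inl, map_one, MulAut.one_apply]
    rw [hsa, piGroup_comm, hdot, add_zero, ← mul_assoc X.left.2, ← zPow_comm, mul_assoc,
      ← mul_assoc (zPow n 1), ← zPow_add, piDeg_eq_parity, ha, piDeg_aProd, List.length_cons, hlen]
    congr 2
    -- The required identity is $(m+1)\deg x=1+m$ modulo 2: the degree cost on one side, $z$ and the
    -- rotation cost on the other.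
    rw [← hX, add_right_comm, CharTwo.add_self_eq_zero, zero_add, Nat.cast_add, Nat.cast_one]
  · rw [zCover_mul_right]
    simp

/-- Two negative cycles with the same data prevent splitting. -/
theorem isConj_of_model {ι : Type*} {len : ι → ℕ} {e : (Sigma fun i => Fin (len i)) ≃ Fin n}
    {val : ι → Γ × Z2} (hlen : ∀ i, 0 < len i) {i₁ i₂ : ι} (hne : i₁ ≠ i₂)
    (hl : len i₁ = len i₂) (hv : val i₁ = val i₂) (hneg : (val i₁).2 ≠ 1) {X : BG Γ n}
    (hX : theta Γ n X = model e val) : IsConj X (zCover Γ n 1 * X) := by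
  classical
  set σ : Equiv.Perm ι := Equiv.swap i₁ i₂ with hσ
  have hcases : ∀ i, len (σ i) = len i ∧ val (σ i) = val i := by
    intro i
    rcases eq_or_ne i i₁ with rfl | h1
    · rw [hσ, Equiv.swap_apply_left, hl, hv]; exact ⟨rfl, rfl⟩
    · rcases eq_or_ne i i₂ with rfl | h2
      · rw [hσ, Equiv.swap_apply_right, hl, hv]; exact ⟨rfl, rfl⟩
      · rw [hσ, Equiv.swap_apply_of_ne_of_ne h1 h2]; exact ⟨rfl, rfl⟩
  have hσl := fun i => (hcases i).1
  set t := modelPerm e σ hσl with ht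
  have hcomm := modelPerm_comm e val σ hσl fun i => (hcases i).2
  have hleft : ∀ i, (model e val).left i =
      (X.left.1 i, Multiplicative.ofAdd (piVec X.left.2 i)) := fun i => by rw [← hX, theta_left]
  have hbase : ∀ i, (val i).2 ≠ 1 → piVec X.left.2 (modelBase e hlen i) ≠ 0 := by
    intro i hi h
    have := hleft (modelBase e hlen i)
    rw [model_left_base, h] at this
    exact hi (by rw [this]; rfl)
  -- Only base points carry nontrivial signs, so among the indices occurring in $X$ the swap moves
  -- just two.
  have hsw : piAction n t X.left.2 = zGen n * X.left.2 := by
    refine piAction_swap (p := modelBase e hlen i₁) (q := modelBase e hlen i₂)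
      ((modelBase_injective e hlen).ne hne) (hbase _ hneg) (hbase _ (hv ▸ hneg)) ?_ ?_ ?_
    · rw [ht, modelPerm_base, hσ, Equiv.swap_apply_left]
    · rw [ht, modelPerm_base, hσ, Equiv.swap_apply_right]
    · intro j hj h1 h2
      obtain ⟨⟨i, k⟩, rfl⟩ := e.surjective j
      by_cases hk : (k : ℕ) = 0
      · have hb : e ⟨i, k⟩ = modelBase e hlen i := by
          rw [modelBase]
          congr 2
          exact Fin.ext hk
        rw [hb] at h1 h2 ⊢
        rw [ht, modelPerm_base, hσ, Equiv.swap_apply_of_ne_of_ne (fun h => h1 (by rw [h]))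
          (fun h => h2 (by rw [h]))]
      · have := hleft (e ⟨i, k⟩)
        rw [model_left_of_ne e val i k hk] at this
        exact absurd (Multiplicative.ofAdd.injective (congrArg Prod.snd this)).symm hj
  -- Commutation below settles the components in $\Gamma^n$ and $S_n$; the power of $z$ is read off
  -- from `hsw`.
  have hT : theta Γ n (SemidirectProduct.inr t * X) = theta Γ n (X * SemidirectProduct.inr t) := by
    have : theta Γ n (SemidirectProduct.inr t) = SemidirectProduct.inr t :=
      SemidirectProduct.map_inr _ _ _ _
    rw [map_mul, map_mul, this, hX, hcomm]
  obtain ⟨f, hf⟩ := exists_zCover_mul hT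
  refine isConj_zCover_of_comm (Y := SemidirectProduct.inr t) (bg_ext ?_ ?_ ?_)
  · rw [hf, zCover_mul_left_fst, zCover_mul_left_fst]
  · rw [zCover_mul_left_snd, mul_left_snd, mul_left_snd, SemidirectProduct.right_inr, hsw]
    simp
  · rw [hf, zCover_mul_right, zCover_mul_right]

end Cover

/-! ### Classes that split -/

section Split

variable {Γ : Type*} [Group Γ] {n : ℕ}

/-- The endomorphism of the double cover that forgets the components in `Γ`. -/
def stripCover (Γ : Type*) [Group Γ] (n : ℕ) : BG Γ n →* BG Γ n where
  toFun X := ⟨(1, X.left.2), X.right⟩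
  map_one' := rfl
  map_mul' X Y := by
    refine bg_ext ?_ rfl rfl
    rw [mul_left_fst]
    simp

/-- The endomorphism of the wreath product that forgets the components in `Γ`. -/
def strip (Γ : Type*) [Group Γ] (n : ℕ) : HG Γ n →* HG Γ n where
  toFun x := ⟨fun i => (1, (x.left i).2), x.right⟩
  map_one' := rfl
  map_mul' _ _ := SemidirectProduct.ext (funext fun _ => Prod.ext (one_mul 1).symm rfl) rfl

theorem theta_stripCover (X : BG Γ n) :
    theta Γ n (stripCover Γ n X) = strip Γ n (theta Γ n X) := rfl

theorem stripCover_zCover (e : ZMod 2) : stripCover Γ n (zCover Γ n e) = zCover Γ n e := rfl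

@[simp] theorem strip_right (x : HG Γ n) : (strip Γ n x).right = x.right := rfl

theorem strip_coeff (x : HG Γ n) (i : Fin n) :
    coeff (strip Γ n x) i = (1, (coeff x i).2) := rfl

theorem strip_holonomy (x : HG Γ n) (i : Fin n) :
    holonomy (strip Γ n x) i = (1, (holonomy x i).2) := by
  rw [holonomy, strip_right, ← map_pow, strip_coeff]
  rfl

/-- An element all of whose cycles are positive and of odd length splits. -/
theorem not_isConj_of_odd_cycles {X : BG Γ n}
    (hodd : ∀ i, Odd (period (theta Γ n X).right i))
    (hpos : ∀ i, (holonomy (theta Γ n X) i).2 = 1) :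
    ¬ IsConj X (zCover Γ n 1 * X) := by
  intro h
  replace h := (stripCover Γ n).map_isConj h
  rw [map_mul, stripCover_zCover] at h
  set X₀ := stripCover Γ n X
  set x₀ := theta Γ n X₀ with hx₀
  have hhol : ∀ i, holonomy x₀ i = 1 := fun i => by
    rw [hx₀, theta_stripCover, strip_holonomy, hpos]; rfl
  -- After stripping, all holonomies are trivial, so any common multiple of the periods kills $x_0$;
  -- the product of the periods is an odd one.
  obtain ⟨N, hN, hdvd⟩ : ∃ N, Odd N ∧ ∀ i, period x₀.right i ∣ N :=
    ⟨∏ i, period x₀.right i,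
      Finset.prod_induction _ Odd (fun _ _ ha hb => ha.mul hb) odd_one fun i _ => hodd i,
      fun i => Finset.dvd_prod_of_mem _ (Finset.mem_univ i)⟩
  have hpow : x₀ ^ N = 1 := by
    refine hg_ext (fun i => ?_) fun i => ?_
    · obtain ⟨l, hl⟩ := hdvd i
      have := coeff_pow_add_mul_period x₀ 0 l i
      rw [zero_add, ← hl, hhol, one_pow, mul_one, pow_zero] at this
      exact this
    · rw [pow_right, perm_pow_apply]
      have h1 : Function.IsPeriodicPt x₀.right N i :=
        Function.isPeriodicPt_iff_minimalPeriod_dvd.2 (hdvd i)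
      exact h1
  obtain ⟨e, he⟩ := exists_zCover_mul (X := X₀ ^ N) (Y := 1) (by rw [map_pow, map_one, ← hpow])
  rw [mul_one] at he
  have hz : zCover Γ n 1 ^ N = zCover Γ n 1 := by
    obtain ⟨k, rfl⟩ := hN
    rw [pow_succ, pow_mul, pow_two, ← zCover_add]
    have h2 : (1 + 1 : ZMod 2) = 0 := by decide
    rw [h2, zCover_zero, one_pow, one_mul]
  obtain ⟨Y, hY⟩ := isConj_iff.1 h
  -- $X_0^N$ is a power of $z$, hence unchanged by conjugation, whereas $(zX_0)^N=zX_0^N$ because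
  -- $N$ is odd.
  have h1 := congrArg (· ^ N) hY
  simp only [conj_pow, Commute.mul_pow (show Commute (zCover Γ n 1) X₀ from zCover_comm 1 X₀)] at h1
  rw [he, hz, ← zCover_comm, mul_inv_cancel_right] at h1
  exact zCover_one_ne_one (right_eq_mul.1 h1)

/-- Triviality of `y` at one point propagates along the cycle of `x`, since `y` commutes with every
$x^k$. -/
theorem comm_iterate {x y : HG Γ n} (h : y * x = x * y) (k : ℕ) {j : Fin n} (hj : y.right j = j)
    (hc : coeff y j = 1) :
    y.right (x.right^[k] j) = x.right^[k] j ∧ coeff y (x.right^[k] j) = 1 := by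
  have hk : y * x ^ k = x ^ k * y := (Commute.pow_right (show Commute y x from h) k)
  constructor
  · have := Equiv.congr_fun (congrArg SemidirectProduct.right hk) j
    rwa [SemidirectProduct.mul_right, SemidirectProduct.mul_right, Equiv.Perm.mul_apply,
      Equiv.Perm.mul_apply, hj, pow_right, perm_pow_apply] at this
  · have := congrArg (fun w => coeff w j) hk
    simp only [coeff_mul, hj, hc, mul_one, pow_right, perm_pow_apply] at this
    exact mul_eq_right.1 this

theorem restrict_pow_apply {x : HG Γ n} {A : Finset (Fin n)} (hA : ∀ i, x.right i ∈ A ↔ i ∈ A)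
    (k : ℕ) (i : Fin n) :
    (restrict x A hA ^ k).right i = (if i ∈ A then x.right^[k] i else i) ∧
      coeff (restrict x A hA ^ k) i = if i ∈ A then coeff (x ^ k) i else 1 := by
  have hmem : ∀ k, x.right^[k] i ∈ A ↔ i ∈ A := by
    intro k
    induction k with
    | zero => rfl
    | succ k ih => rw [Function.iterate_succ_apply', hA, ih]
  have hr : ∀ k, (restrict x A hA ^ k).right i = if i ∈ A then x.right^[k] i else i := by
    intro k
    induction k with
    | zero => simp
    | succ k ih =>
      rw [pow_succ', SemidirectProduct.mul_right, Equiv.Perm.mul_apply, ih, restrict_right_apply]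
      by_cases h : i ∈ A
      · simp only [h, if_true, (hmem k).2 h, Function.iterate_succ_apply']
      · simp [h]
  refine ⟨hr k, ?_⟩
  induction k with
  | zero => simp
  | succ k ih =>
    rw [pow_succ', coeff_mul, ih, hr, restrict_coeff, coeff_pow_succ]
    by_cases h : i ∈ A
    · simp only [h, if_true, (hmem k).2 h]
    · simp [h]

open Classical in
/-- If all cycles of `x` are negative, then an element without `Γ`-components that commutes with
`x` and preserves each of its cycles is a product of restrictions of `x` to cycles. -/
theorem mem_of_commute {x : HG Γ n} (hx : ∀ i, (holonomy x i) = (1, Multiplicative.ofAdd 1))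
    (hx1 : ∀ k i, (coeff (x ^ k) i).1 = 1) (H : Subgroup (HG Γ n))
    (hH : ∀ q, restrict x _ (cycleSupport_invariant x.right q) ∈ H) (m : ℕ) :
    ∀ y : HG Γ n, (Finset.univ.filter fun i => ¬ (y.right i = i ∧ coeff y i = 1)).card ≤ m →
      y * x = x * y → (∀ i, (Quotient.mk _ (y.right i) : Cycles x.right) = Quotient.mk _ i) →
      (∀ i, (coeff y i).1 = 1) → y ∈ H := by
  -- Induction on the number of points at which `y` is nontrivial; each step clears one whole cycle.
  induction m with
  | zero =>
    intro y hm _ _ _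
    have hy : ∀ i, y.right i = i ∧ coeff y i = 1 := by
      simpa [Finset.filter_eq_empty_iff] using hm
    rw [hg_ext (x := y) (y := 1) (fun i => (hy i).2) fun i => (hy i).1]
    exact H.one_mem
  | succ m ih =>
    intro y hm hcomm hcyc hone
    by_cases hall : ∀ i, y.right i = i ∧ coeff y i = 1
    · rw [hg_ext (x := y) (y := 1) (fun i => (hall i).2) fun i => (hall i).1]
      exact H.one_mem
    obtain ⟨j, hj⟩ := not_forall.1 hall
    -- Some power of `x` moves `j` as `y` does. If the sign is wrong, one more turn corrects it,
    -- because the holonomy is the nontrivial sign.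
    obtain ⟨k, hk, hck⟩ : ∃ k, x.right^[k] j = y.right j ∧ coeff (x ^ k) j = coeff y j := by
      obtain ⟨k, hk⟩ := exists_iterate_of_mk_eq (hcyc j).symm
      by_cases hck : (coeff (x ^ k) j).2 = (coeff y j).2
      · exact ⟨k, hk, Prod.ext (by rw [hx1, hone]) hck⟩
      · refine ⟨k + period x.right j, ?_, Prod.ext (by rw [hx1, hone]) ?_⟩
        · rw [Function.iterate_add_apply, iterate_period, hk]
        · rw [coeff_pow_add_period, hx, Prod.snd_mul]
          change _ * Multiplicative.ofAdd 1 = _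
          revert hck
          generalize (coeff (x ^ k) j).2 = a
          generalize (coeff y j).2 = b
          revert a b
          decide
    set A := cycleSupport x.right (Quotient.mk _ j) with hA
    have hinv := cycleSupport_invariant x.right (Quotient.mk _ j)
    have hjA : j ∈ A := mem_cycleSupport.2 rfl
    set w := restrict x A hinv ^ k with hw
    obtain ⟨y', rfl⟩ : ∃ y', y = w * y' := ⟨w⁻¹ * y, (mul_inv_cancel_left _ _).symm⟩
    have hwr := fun i => (restrict_pow_apply hinv k i).1
    have hwc := fun i => (restrict_pow_apply hinv k i).2
    rw [← hw] at hwr hwc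
    have hyr : ∀ i, (w * y').right i = w.right (y'.right i) := fun i => rfl
    have hwx : Commute w x := Commute.pow_left (restrict_comm_self hinv) k
    have hcomm' : y' * x = x * y' := by
      rw [mul_assoc, ← mul_assoc x, ← hwx.eq, mul_assoc] at hcomm
      exact mul_left_cancel hcomm
    have hwcyc : ∀ i, (Quotient.mk _ (w.right i) : Cycles x.right) = Quotient.mk _ i := by
      intro i
      rw [hwr]
      split_ifs
      · exact mk_iterate_eq _ _ _
      · rfl
    have hwone : ∀ i, (coeff w i).1 = 1 := by
      intro i
      rw [hwc]
      split_ifs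
      · exact hx1 k i
      · rfl
    have hy'j : y'.right j = j ∧ coeff y' j = 1 := by
      have h1 : y'.right j = j := by
        apply w.right.injective
        rw [← hyr, ← hk, hwr, if_pos hjA]
      refine ⟨h1, ?_⟩
      rw [coeff_mul, h1, hwc, if_pos hjA] at hck
      exact (left_eq_mul.1 hck)
    refine H.mul_mem (H.pow_mem (hH _) k) (ih y' ?_ hcomm' ?_ ?_)
    -- Dividing by `w` makes `j` trivial. No good point is lost: off `A` the factor `w` is trivial,
    -- and on `A` every point was bad for `y`, by `comm_iterate`.
    · refine Nat.le_of_lt_succ (lt_of_lt_of_le (Finset.card_lt_card ?_) hm)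
      refine Finset.ssubset_iff_of_subset ?_ |>.2 ⟨j, by simpa using hj, by simpa using hy'j⟩
      intro i hi
      rw [Finset.mem_filter] at hi ⊢
      refine ⟨hi.1, fun hgood => hi.2 ?_⟩
      have hiA : i ∉ A := by
        intro hiA
        obtain ⟨l, rfl⟩ := exists_iterate_of_mk_eq (mem_cycleSupport.1 hiA)
        exact hj (comm_iterate hcomm l hgood.1 hgood.2)
      have h1 : y'.right i = i := by
        apply w.right.injective
        rw [← hyr, hgood.1, hwr, if_neg hiA]
      refine ⟨h1, ?_⟩
      have h2 := hgood.2
      rwa [coeff_mul, h1, hwc, if_neg hiA, one_mul] at h2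
    · intro i
      rw [← hwcyc, ← hyr, hcyc]
    · intro i
      have := hone i
      rwa [coeff_mul, Prod.fst_mul, hwone, one_mul] at this

/-- An odd element all of whose cycles are negative, with pairwise distinct data, splits. -/
theorem not_isConj_of_neg_cycles {X : BG Γ n}
    (hX : parity (theta Γ n X) Finset.univ = 1)
    (hneg : ∀ i, (holonomy (theta Γ n X) i).2 = Multiplicative.ofAdd 1)
    (hinj : Function.Injective (cycleData (theta Γ n X))) :
    ¬ IsConj X (zCover Γ n 1 * X) := by
  intro h
  obtain ⟨Y, hY⟩ := isConj_iff.1 h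
  rw [mul_inv_eq_iff_eq_mul] at hY
  have hxy : theta Γ n Y * theta Γ n X = theta Γ n X * theta Γ n Y := by
    rw [← map_mul, hY, map_mul, map_mul, theta_zCover, one_mul]
  -- Commuting elements permute cycles with equal data, and here the data are pairwise distinct.
  have hcyc : ∀ i, (Quotient.mk _ ((theta Γ n Y).right i) : Cycles (theta Γ n X).right) =
      Quotient.mk _ i := fun i => hinj (cycleData_conj hxy i)
  have hY₀ := congrArg (stripCover Γ n) hY
  rw [map_mul, map_mul, map_mul, stripCover_zCover] at hY₀
  set X₀ := stripCover Γ n X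
  set Y₀ := stripCover Γ n Y
  have hθX : theta Γ n X₀ = strip Γ n (theta Γ n X) := rfl
  have hθY : theta Γ n Y₀ = strip Γ n (theta Γ n Y) := rfl
  -- It suffices to lift the restrictions to single cycles into the centralizer.
  have hmem : theta Γ n Y₀ ∈ (Subgroup.centralizer {X₀}).map (theta Γ n) := by
    refine mem_of_commute (x := theta Γ n X₀) (fun i => ?_) (fun k i => ?_) _ (fun q => ?_) _ _ le_rfl
      ?_ hcyc fun i => rfl
    · rw [hθX, strip_holonomy, hneg]
    · rw [hθX, ← map_pow]
      rfl
    · obtain ⟨R, hR⟩ := theta_surjective (restrict (theta Γ n X₀) _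
        (cycleSupport_invariant (theta Γ n X₀).right q))
      refine ⟨R, ?_, hR⟩
      have hc := lift_restrict_comm _ rfl hR
      have h1 : parity (theta Γ n X₀) (cycleSupport (theta Γ n X₀).right q) = 1 := by
        obtain ⟨i, rfl⟩ := Quotient.exists_rep q
        rw [parity_cycle, hθX, strip_holonomy, hneg]
        rfl
      have h2 := parity_add_compl (theta Γ n X₀) (cycleSupport (theta Γ n X₀).right q)
      -- Total and cycle are both odd, so the complement is even and the commutation exponent
      -- vanishes.
      rw [h1, show parity (theta Γ n X₀) Finset.univ = 1 from hX, add_eq_left] at h2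
      rw [h2, mul_zero, zCover_zero, one_mul] at hc
      exact Subgroup.mem_centralizer_singleton_iff.2 hc
    · rw [hθX, hθY, ← map_mul, hxy, map_mul]
  obtain ⟨Y₁, hY₁, hθ⟩ := hmem
  obtain ⟨e, he⟩ := exists_zCover_mul hθ
  have hc : Y₀ * X₀ = X₀ * Y₀ := by
    have h1 : Y₁ * X₀ = X₀ * Y₁ := Subgroup.mem_centralizer_singleton_iff.1 hY₁
    rw [he, mul_assoc, ← mul_assoc X₀, ← zCover_comm, mul_assoc] at h1
    exact mul_left_cancel h1
  rw [hc, mul_assoc] at hY₀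
  exact zCover_one_ne_one (right_eq_mul.1 hY₀)

end Split

/-! ### Types of split classes -/

section Types

variable {Γ : Type*} [Group Γ] {n : ℕ}

theorem parity_univ_eq (x : HG Γ n) : parity x Finset.univ = ((negSet x).card : ZMod 2) := by
  rw [parity_eq_card, Finset.inter_univ]

theorem parts_emptyFun (c : ConjClasses Γ) : (emptyFun c : Ptn).parts = 0 := rfl

theorem normSize_emptyFun [Finite Γ] : normSize (emptyFun : ConjClasses Γ → Ptn) = 0 := by
  simp [normSize, emptyFun, Ptn.empty, Ptn.ofParts, Ptn.size]

theorem rho_eq_emptyFun_iff {x : HG Γ n} {ε : ℤˣ} :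
    rho x ε = emptyFun ↔ ∀ q : Cycles x.right, cycleSign x q ≠ ε := by
  constructor
  · rintro h q rfl
    have : cycleLength x.right q ∈ (rho x (cycleSign x q) (cycleClass x q)).parts :=
      mem_rho_parts.2 ⟨q, rfl⟩
    rw [h, parts_emptyFun] at this
    exact Multiset.notMem_zero _ this
  · intro h
    funext c
    refine Ptn.ext ?_
    rw [parts_emptyFun]
    refine Multiset.eq_zero_of_forall_notMem fun m hm => ?_
    obtain ⟨q, hq⟩ := mem_rho_parts.1 hm
    exact h q (congrArg (fun d => d.2.1) hq)

/-- Each negative cycle contributes 1 to the parity, so the number of cycles has the parity of the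
element. -/
theorem totalLength_cast [Finite Γ] {x : HG Γ n}
    (h : ∀ q : Cycles x.right, cycleSign x q = -1) :
    (totalLength (rho x (-1)) : ZMod 2) = parity x Finset.univ := by
  classical
  have := Fintype.ofFinite (ConjClasses Γ)
  have h1 : totalLength (rho x (-1)) = Fintype.card (Cycles x.right) := by
    rw [totalLength, finsum_eq_sum_of_fintype, ← Finset.card_univ,
      Finset.card_eq_sum_card_fiberwise (f := cycleClass x) (t := Finset.univ) (by simp)]
    refine Finset.sum_congr rfl fun c _ => ?_
    rw [Ptn.length, rho_parts, Multiset.card_map, Finset.card_def]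
    congr 2
    ext q
    simp [h]
  rw [h1, parity, ← Finset.sum_fiberwise Finset.univ
    (fun i => (Quotient.mk _ i : Cycles x.right)) fun i => Multiplicative.toAdd (x.left i).2]
  have h2 : ∀ q : Cycles x.right, ∑ i ∈ Finset.univ.filter
      (fun i => (Quotient.mk _ i : Cycles x.right) = q), Multiplicative.toAdd (x.left i).2 = 1 := by
    intro q
    rw [← parity_eq_one_of_cycleSign (h q), parity]
    refine Finset.sum_congr ?_ fun _ _ => rfl
    ext i
    simp [mem_cycleSupport]
  simp [h2, Finset.card_univ]

theorem cycleData_injective {x : HG Γ n} (h : ∀ q : Cycles x.right, cycleSign x q = -1)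
    (hnodup : ∀ c, (rho x (-1) c).parts.Nodup) : Function.Injective (cycleData x) := by
  classical
  intro q q' hq
  have h1 := Multiset.nodup_iff_count_le_one.1 (hnodup (cycleClass x q)) (cycleLength x.right q)
  rw [count_rho_parts, Fintype.card_le_one_iff] at h1
  have hd : cycleData x q = (cycleLength x.right q, -1, cycleClass x q) := by rw [cycleData, h]
  exact congrArg Subtype.val (h1 ⟨q, hd⟩ ⟨q', hq.symm.trans hd⟩)

/-- Splitting may be tested on any representative; in the model, cycles of the same type have equal
holonomies, not merely conjugate ones, so a plain swap is a symmetry. -/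
theorem not_splits_of_not_nodup [Finite Γ] {ρpos ρneg : ConjClasses Γ → Ptn}
    (hn : normSize ρpos + normSize ρneg = n) {c : ConjClasses Γ} (hc : ¬ (ρneg c).parts.Nodup) :
    ¬ Splits (classOfType n ρpos ρneg) := by
  obtain ⟨e⟩ := exists_typeIndex_equiv hn
  obtain ⟨X, hX⟩ := theta_surjective (model e typeVal)
  rw [splits_iff (X := X) (hX ▸ model_mem_classOfType e), not_not]
  obtain ⟨m, hm⟩ := not_forall.1 (mt Multiset.nodup_iff_count_le_one.2 hc)
  have hparts : typeParts ρpos ρneg (-1, c) = (ρneg c).parts := rfl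
  have hm' : 1 < (typeParts ρpos ρneg (-1, c)).count m := by rw [hparts]; exact not_le.1 hm
  let a : (typeParts ρpos ρneg (-1, c)).ToType := ⟨m, ⟨0, by omega⟩⟩
  let b : (typeParts ρpos ρneg (-1, c)).ToType := ⟨m, ⟨1, hm'⟩⟩
  refine isConj_of_model (typeIndex_len_pos ρpos ρneg)
    (i₁ := ⟨(-1, c), a⟩) (i₂ := ⟨(-1, c), b⟩) ?_ rfl rfl ?_ hX
  · intro h
    have h1 : a = b := by simpa using h
    have h2 := congrArg (fun t => (t.2 : ℕ)) h1
    exact absurd h2 (by simp [a, b])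
  · change signToZ2 (-1) ≠ 1
    decide

end Types

end SpinWreath

/-! ### The main theorem -/

theorem mainTheorem4 {Γ : Type*} [Group Γ] [Finite Γ] (n : ℕ)
    (ρpos ρneg : ConjClasses Γ → SpinWreath.Ptn)
    (hn : SpinWreath.normSize ρpos + SpinWreath.normSize ρneg = n) :
    (SpinWreath.IsEvenClass (SpinWreath.classOfType n ρpos ρneg) →
      (SpinWreath.Splits (SpinWreath.classOfType n ρpos ρneg) ↔
        ρpos ∈ SpinWreath.OP n (ConjClasses Γ) ∧ ρneg = SpinWreath.emptyFun)) ∧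
    (SpinWreath.IsOddClass (SpinWreath.classOfType n ρpos ρneg) →
      (SpinWreath.Splits (SpinWreath.classOfType n ρpos ρneg) ↔
        ρpos = SpinWreath.emptyFun ∧ ρneg ∈ SpinWreath.SPminus n (ConjClasses Γ))) := by
  open SpinWreath in
  -- An actual element is needed: on an empty set both parity conditions would hold vacuously.
  obtain ⟨x, hx⟩ := classOfType_nonempty hn
  obtain ⟨X, rfl⟩ := theta_surjective x
  have hsplit := splits_iff hx
  have hpos : rho (theta Γ n X) 1 = ρpos := hx.1
  have hneg : rho (theta Γ n X) (-1) = ρneg := hx.2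
  have hsign := fun q => Int.units_eq_one_or (cycleSign (theta Γ n X) q)
  constructor
  · intro heven
    have hpar : parity (theta Γ n X) Finset.univ = 0 := by
      rw [parity_univ_eq, ZMod.natCast_eq_zero_iff_even]
      exact heven _ hx
    constructor
    · intro hs
      have hnc := hsplit.1 hs
      have hempty : ρneg = emptyFun := by
        rw [← hneg]
        exact rho_eq_emptyFun_iff.2 fun q hq => hnc (isConj_of_neg_cycle hpar hq)
      refine ⟨⟨by rw [← hn, hempty, normSize_emptyFun, add_zero], fun c m hm => ?_⟩, hempty⟩
      rw [← hpos] at hm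
      obtain ⟨q, hq⟩ := mem_rho_parts.1 hm
      obtain ⟨hl, hs, -⟩ : _ ∧ _ ∧ _ := by simpa [cycleData] using hq
      refine Nat.not_even_iff_odd.1 fun hev => hnc ?_
      obtain ⟨k, hk⟩ := Nat.exists_eq_succ_of_ne_zero (hl ▸ (cycleLength_pos _ q).ne')
      refine isConj_of_pos_cycle hs (hl.trans hk) ?_
      -- For an even element the exponent reduces to $k$, which is odd exactly when the length $k+1$
      -- is even.
      rw [hpar, mul_zero, add_zero, ZMod.natCast_eq_one_iff_odd]
      rw [hk] at hev
      exact Nat.not_even_iff_odd.1 (Nat.even_add_one.1 hev)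
    · rintro ⟨⟨-, hodd⟩, hempty⟩
      rw [← hneg, rho_eq_emptyFun_iff] at hempty
      have hone := fun q => (hsign q).resolve_right (hempty q)
      refine hsplit.2 (not_isConj_of_odd_cycles (fun i => ?_) fun i =>
        (cycleSign_mk_eq_one_iff _ i).1 (hone _))
      rw [← cycleLength_mk]
      refine hodd (cycleClass (theta Γ n X) (Quotient.mk _ i)) _ ?_
      rw [← hpos]
      exact mem_rho_parts.2 ⟨Quotient.mk _ i, by rw [cycleData, hone]⟩
  · intro hodd
    have hpar : parity (theta Γ n X) Finset.univ = 1 := by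
      rw [parity_univ_eq, ZMod.natCast_eq_one_iff_odd]
      exact hodd _ hx
    constructor
    · intro hs
      have hnc := hsplit.1 hs
      have hnopos : ∀ q, cycleSign (theta Γ n X) q ≠ 1 := fun q hq => by
        obtain ⟨k, hk⟩ := Nat.exists_eq_succ_of_ne_zero (cycleLength_pos _ q).ne'
        refine hnc (isConj_of_pos_cycle hq hk ?_)
        -- For an odd element the exponent is $k+(k+1)=1$ whatever the length.
        rw [hpar, mul_one, ← add_assoc, CharTwo.add_self_eq_zero, zero_add]
      have hempty : ρpos = emptyFun := by
        rw [← hpos]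
        exact rho_eq_emptyFun_iff.2 hnopos
      refine ⟨hempty, by rw [← hn, hempty, normSize_emptyFun, zero_add], fun c => ?_, ?_⟩
      · by_contra hc
        exact not_splits_of_not_nodup hn hc hs
      · rw [← hneg, ← ZMod.natCast_eq_one_iff_odd,
          totalLength_cast fun q => (hsign q).resolve_left (hnopos q), hpar]
    · rintro ⟨hempty, -, hnodup, -⟩
      rw [← hpos, rho_eq_emptyFun_iff] at hempty
      have hall := fun q => (hsign q).resolve_left (hempty q)
      refine hsplit.2 (not_isConj_of_neg_cycles hpar (fun i => ?_)
        (cycleData_injective hall fun c => by rw [hneg]; exact hnodup c))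
      exact (z2_cases _).resolve_left fun h => hempty _ ((cycleSign_mk_eq_one_iff _ i).2 h)
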